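/- **Setting.** Let $\mathcal I$ be a finite index set with $|\mathcal I|\ge 2$, and for $i\in\mathcal I$ let $S_i(x,y)=(c_ix,d_iy)+(a_i,b_i)$ with $c_i,d_i\in(0,1)$ and $(a_i,b_i)\in\mathbb R^2$, so that $S_i$ maps $[0,1]^2$ onto $[a_i,a_i+c_i]\times[b_i,b_i+d_i]$. Suppose that at least one $S_i$ is not a similarity and that $\{S_i\}_{i\in\mathcal I}$ belongs to one of the following classes. * *Extended Lalley–Gatzouras class:* $[0,1]^2$ is divided into at least two columns by vertical lines, each column is divided independently into rectangles by horizontal slicing, and the sets $S_i([0,1]^2)$ are distinct rectangles of this division, each with base at least as long as its height ($c_i\ge d_i$); or the same holds after interchanging the two coordinates. * *Barański class:* $[0,1]^2$ is divided into a grid by finitely many vertical and horizontal lines (at least one of each), and the sets $S_i([0,1]^2)$ are distinct rectangles of this grid. Let $F$ be the attractor, i.e. the unique non-empty compact set with $F=\bigcup_{i\in\mathcal I}S_i(F)$ (a self-affine carpet). It is of *horizontal type* if $c_i\ge d_i$ for all $i$, of *vertical type* if $c_i\le d_i$ for all $i$, and of *mixed type* otherwise. Let $\pi_1,\pi_2$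 be the projections to the horizontal and vertical axis, and let $\mathrm{Slice}_{1,i}(F)$ and $\mathrm{Slice}_{2,i}(F)$ be the intersections of $F$ with the vertical and with the horizontal line, respectively, through the fixed point of $S_i$. For $r>0$ let $N_r(A)$ be the smallest number of open sets of diameter at most $r$ needed to cover $A$. The Assouad dimension $\dim_{\mathrm A}F$ is the infimum of all $\alpha$ for which there are $C,\rho>0$ such that $N_r(B(x,R)\cap F)\le C(R/r)^\alpha$ for all $0<r<R\le\rho$ and $x\in F$, where $B(x,R)$ is the closed ball. The box dimension is $\dim_{\mathrm B}A=\lim_{r\to0^+}\log N_r(A)/(-\log r)$, if the limit exists. **Theorem.** In each of the following cases all the box dimensions that appear exist. * If $F$ is of horizontal type, then $$\dim_{\mathrm A}F=\dim_{\mathrm B}\pi_1(F)+\max_{i\in\mathcal I}\dim_{\mathrm B}\mathrm{Slice}_{1,i}(F).$$ * If $F$ is of vertical type, then $$\dim_{\mathrm A}F=\dim_{\mathrm B}\pi_2(F)+\max_{i\in\mathcal I}\dim_{\mathrm B}\mathrm{Slice}_{2,i}(F).$$ * If $F$ is of mixed type, then $$\dim_{\mathrm A}F=\max_{i\in\mathcal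 I}\,\max_{j=1,2}\Big(\dim_{\mathrm B}\pi_j(F)+\dim_{\mathrm B}\mathrm{Slice}_{j,i}(F)\Big).$$ -/

import Mathlib

open Set Filter Topology

noncomputable section

/-- `N_r(A)`: the smallest number of open sets of diameter at most `r` needed to cover `A`
(equal to `⊤` if no finite family does). -/
def openCoverNumber {X : Type*} [PseudoMetricSpace X] (r : ℝ) (A : Set X) : ℕ∞ :=
  ⨅ (𝒰 : Set (Set X)) (_ : ∀ U ∈ 𝒰, IsOpen U ∧ Metric.ediam U ≤ ENNReal.ofReal r)
    (_ : A ⊆ ⋃₀ 𝒰), 𝒰.encard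

/-- The Assouad dimension of a non-empty set `A`: the infimum, in the extended reals, of all real
exponents `α` for which there are `C, ρ > 0` such that, for all `0 < r < R ≤ ρ` and all `x ∈ A`,
`N_r (B(x, R) ∩ A) ≤ C (R / r) ^ α`. -/
def assouadDim {X : Type*} [PseudoMetricSpace X] (A : Set X) : EReal :=
  sInf ((fun α : ℝ => (α : EReal)) ''
    {α : ℝ | ∃ C > 0, ∃ ρ > 0, ∀ r R : ℝ, 0 < r → r < R → R ≤ ρ → ∀ x ∈ A,
      ((openCoverNumber r (Metric.closedBall x R ∩ A) : ℕ∞) : ENNReal)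
        ≤ ENNReal.ofReal (C * (R / r) ^ α)})

/-- The lower box dimension, `liminf_{r → 0+} log N_r(A) / (- log r)`. -/
def lowerBoxDim {X : Type*} [PseudoMetricSpace X] (A : Set X) : EReal :=
  liminf (fun r : ℝ => ENNReal.log ((openCoverNumber r A : ℕ∞) : ENNReal)
    / ((-Real.log r : ℝ) : EReal)) (𝓝[>] 0)

/-- The upper box dimension, `limsup_{r → 0+} log N_r(A) / (- log r)`. -/
def upperBoxDim {X : Type*} [PseudoMetricSpace X] (A : Set X) : EReal :=
  limsup (fun r : ℝ => ENNReal.log ((openCoverNumber r A : ℕ∞) : ENNReal)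
    / ((-Real.log r : ℝ) : EReal)) (𝓝[>] 0)

/-- The box dimension of `A` exists and is the real number `s`. -/
def HasBoxDim {X : Type*} [PseudoMetricSpace X] (A : Set X) (s : ℝ) : Prop :=
  lowerBoxDim A = (s : EReal) ∧ upperBoxDim A = (s : EReal)

theorem HasBoxDim.unique {X : Type*} [PseudoMetricSpace X] {A : Set X} {s t : ℝ}
    (hs : HasBoxDim A s) (ht : HasBoxDim A t) : s = t :=
  EReal.coe_injective (hs.1.symm.trans ht.1)

/-- An iterated function system of maps `(x, y) ↦ (c i * x, d i * y) + (a i, b i)` of the plane,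
with contraction constants `c i, d i ∈ (0, 1)`. -/
structure DiagonalIFS (I : Type*) where
  c : I → ℝ
  d : I → ℝ
  a : I → ℝ
  b : I → ℝ
  c_mem : ∀ i, c i ∈ Ioo (0 : ℝ) 1
  d_mem : ∀ i, d i ∈ Ioo (0 : ℝ) 1

namespace DiagonalIFS

variable {I : Type*}

/-- The `i`-th map of the system, on the Euclidean plane. -/
def map (S : DiagonalIFS I) (i : I) (p : EuclideanSpace ℝ (Fin 2)) : EuclideanSpace ℝ (Fin 2) :=
  !₂[S.c i * p 0 + S.a i, S.d i * p 1 + S.b i]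

/-- `F` is the attractor: the non-empty compact set with `F = ⋃ i, S_i(F)`. -/
def IsAttractor (S : DiagonalIFS I) (F : Set (EuclideanSpace ℝ (Fin 2))) : Prop :=
  F.Nonempty ∧ IsCompact F ∧ F = ⋃ i, S.map i '' F

/-- The system with the two coordinates interchanged. -/
def swap (S : DiagonalIFS I) : DiagonalIFS I where
  c := S.d
  d := S.c
  a := S.b
  b := S.a
  c_mem := S.d_mem
  d_mem := S.c_mem

/-- The fixed point of the `i`-th map. -/
def fixedPoint (S : DiagonalIFS I) (i : I) : EuclideanSpace ℝ (Fin 2) :=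
  !₂[S.a i / (1 - S.c i), S.b i / (1 - S.d i)]

theorem isFixedPt_map_iff (S : DiagonalIFS I) (i : I) (p : EuclideanSpace ℝ (Fin 2)) :
    Function.IsFixedPt (S.map i) p ↔ p = S.fixedPoint i := by
  have hc : 1 - S.c i ≠ 0 := by have := (S.c_mem i).2; linarith
  have hd : 1 - S.d i ≠ 0 := by have := (S.d_mem i).2; linarith
  have key : ∀ u v w : ℝ, 1 - u ≠ 0 → (u * w + v = w ↔ w = v / (1 - u)) := by
    intro u v w h
    rw [eq_div_iff h]
    constructor <;> intro h' <;> linarith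
  rw [Function.IsFixedPt, PiLp.ext_iff, PiLp.ext_iff, Fin.forall_fin_two, Fin.forall_fin_two]
  simpa [map, fixedPoint] using and_congr (key _ _ _ hc) (key _ _ _ hd)

/-- `cut 0 = 0 < cut 1 < ⋯ < cut k = 1`: a division of the unit interval into `k` intervals. -/
def IsDivision {k : ℕ} (cut : Fin (k + 1) → ℝ) : Prop :=
  StrictMono cut ∧ cut 0 = 0 ∧ cut (Fin.last k) = 1

/-- The `i`-th map sends the unit square onto the rectangle `[x₀, x₁] × [y₀, y₁]`. -/
def MapsOntoRect (S : DiagonalIFS I) (i : I) (x₀ x₁ y₀ y₁ : ℝ) : Prop :=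
  S.a i = x₀ ∧ S.a i + S.c i = x₁ ∧ S.b i = y₀ ∧ S.b i + S.d i = y₁

/-- The extended Lalley–Gatzouras class: the unit square is divided into `m ≥ 2` columns, each
column `k` is divided independently into `n k` rectangles, and the maps correspond to distinct
rectangles (`cell` is injective) whose bases are at least as long as their heights. -/
def IsExtendedLalleyGatzouras (S : DiagonalIFS I) : Prop :=
  ∃ (m : ℕ) (x : Fin (m + 1) → ℝ) (n : Fin m → ℕ) (y : (k : Fin m) → Fin (n k + 1) → ℝ)
    (cell : I → (k : Fin m) × Fin (n k)),
    2 ≤ m ∧ IsDivision x ∧ (∀ k, IsDivision (y k)) ∧ Function.Injective cell ∧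
    ∀ i, S.MapsOntoRect i (x (cell i).1.castSucc) (x (cell i).1.succ)
        (y (cell i).1 (cell i).2.castSucc) (y (cell i).1 (cell i).2.succ) ∧
      S.d i ≤ S.c i

/-- The Barański class: the unit square is divided into `m ≥ 2` columns and `n ≥ 2` rows, and the
maps correspond to distinct rectangles of the resulting grid. -/
def IsBaranski (S : DiagonalIFS I) : Prop :=
  ∃ (m n : ℕ) (x : Fin (m + 1) → ℝ) (y : Fin (n + 1) → ℝ) (cell : I → Fin m × Fin n),
    2 ≤ m ∧ 2 ≤ n ∧ IsDivision x ∧ IsDivision y ∧ Function.Injective cell ∧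
    ∀ i, S.MapsOntoRect i (x (cell i).1.castSucc) (x (cell i).1.succ)
        (y (cell i).2.castSucc) (y (cell i).2.succ)

/-- The system defines a self-affine carpet: it lies in the extended Lalley–Gatzouras class (up to
interchanging the coordinates) or in the Barański class, and at least one of its maps is not a
similarity. -/
def IsCarpetSystem (S : DiagonalIFS I) : Prop :=
  (S.IsExtendedLalleyGatzouras ∨ S.swap.IsExtendedLalleyGatzouras ∨ S.IsBaranski) ∧
  ∃ i, ¬ ∃ ρ : ℝ, ∀ p q, dist (S.map i p) (S.map i q) = ρ * dist p q

def IsHorizontal (S : DiagonalIFS I) : Prop := ∀ i, S.d i ≤ S.c i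

def IsVertical (S : DiagonalIFS I) : Prop := ∀ i, S.c i ≤ S.d i

def IsMixed (S : DiagonalIFS I) : Prop := ¬ S.IsHorizontal ∧ ¬ S.IsVertical

/-- The slice of `F` through the fixed point of the `i`-th map on which the `j`-th coordinate is
constant: the vertical slice for `j = 0` and the horizontal slice for `j = 1`. -/
def slice (S : DiagonalIFS I) (F : Set (EuclideanSpace ℝ (Fin 2))) (j : Fin 2) (i : I) :
    Set (EuclideanSpace ℝ (Fin 2)) :=
  {p ∈ F | p j = S.fixedPoint i j}

end DiagonalIFS

/-- The projection of a plane set to the `j`-th axis: horizontal for `j = 0`, vertical for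
`j = 1`. -/
def axisProj (j : Fin 2) (F : Set (EuclideanSpace ℝ (Fin 2))) : Set ℝ :=
  (fun p => p j) '' F

end

/-!
Every statement is reduced to counting words. A complete prefix code of words with contraction ratio
about `r` cuts a self-similar set into pieces of size about `r`; a multiplicative weight of total
mass one keeps total mass one on such a code, so the code has about `r ^ (-s)` members, where
`∑ k, c k ^ s = 1`. Since the cylinders do not overlap, boundedly many of them meet a set of
diameter `r` (`card_le_of_apart`). This yields the box dimensions (`hasBoxDim_of_line`) of the
projection of `F`, with one map for each column, and of the slices: the vertical slice through the
fixed point of `S_i` is a self-similar set, with one map for each rectangle in the column of `i`,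
because the fixed point lies on the boundary of its column only if that is the boundary of the unit
square (`DiagonalIFS.Columns.col_eq_of_map_zero_eq`).

Let `s` be the dimension of the projection and `t` that of the slice of a column `k`. If some map
`S_j` contracts more strongly in the vertical direction, then `S_j ^ n` maps the square to a
rectangle much wider than high. Its intersection with a subcolumn of type `k, …, k` as wide as the
rectangle is high is, on a long range of scales, as large as a product of the slice and the
projection. So the Assouad dimension is at least `s + t`
(`DiagonalIFS.Columns.le_assouadDim`).

For the upper bound, a ball of radius `R` meets boundedly many images of the square with shorter
side about `R`. If the height is the shorter side, then the image of `F` within the ball is an affine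
copy of a vertical strip of `F`, which has to be covered by `O(ρ ^ (-α))` rectangles whose sides are
`ρ` times those of the strip. Such covers are counted by recursion on the pieces `S_i(F)`: a bound
`G w h` for the number of `w × h` rectangles is inherited if `∑ i, G (w / c i) (h / d i) ≤ G w h`,
and likewise within a single column. With the maximal slice dimension `t`, the function
`w ^ (-s) * h ^ (-t)` has these properties, and it is correct when `h` is about one. In the
horizontal case the condition `w ≤ h` is preserved, so that this suffices
(`DiagonalIFS.Columns.stripBound_of_horizontal`). In a grid, where `w` may reach one before `h`
does, the corresponding function for the rows is added
(`DiagonalIFS.Columns.stripBound_of_grid`).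
-/

/-! ### Words, prefix codes and packing -/

/-- The contraction ratio `c (k₁) ⋯ c (kₙ)` of the composition of maps coded by a word. -/
def wordScale {K : Type*} (c : K → ℝ) : List K → ℝ
  | [] => 1
  | k :: w => c k * wordScale c w

/-- The translation part of the composition, coded by a word, of the maps `x ↦ c k * x + a k`. -/
def wordShift {K : Type*} (c a : K → ℝ) : List K → ℝ
  | [] => 0
  | k :: w => a k + c k * wordShift c a w

section Words

variable {K L : Type*} {c a : K → ℝ}

theorem wordScale_append (c : K → ℝ) (v w : List K) :
    wordScale c (v ++ w) = wordScale c v * wordScale c w := by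
  induction v with
  | nil => simp [wordScale]
  | cons k v ih => simp [wordScale, ih, mul_assoc]

theorem wordShift_append (c a : K → ℝ) (v w : List K) :
    wordShift c a (v ++ w) = wordShift c a v + wordScale c v * wordShift c a w := by
  induction v with
  | nil => simp [wordScale, wordShift]
  | cons k v ih => simp only [wordScale, wordShift, List.cons_append, ih]; ring

theorem wordScale_replicate (c : K → ℝ) (n : ℕ) (k : K) :
    wordScale c (List.replicate n k) = c k ^ n := by
  induction n with
  | zero => simp [wordScale]
  | succ n ih => simp [wordScale, List.replicate_succ, ih, pow_succ']

theorem wordScale_map (c : K → ℝ) (f : L → K) (w : List L) :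
    wordScale c (w.map f) = wordScale (fun l => c (f l)) w := by
  induction w with
  | nil => rfl
  | cons k w ih => simp [wordScale, ih]

theorem wordShift_map (c a : K → ℝ) (f : L → K) (w : List L) :
    wordShift c a (w.map f) = wordShift (fun l => c (f l)) (fun l => a (f l)) w := by
  induction w with
  | nil => rfl
  | cons k w ih => simp [wordShift, ih]

theorem wordScale_pos (hc : ∀ k, 0 < c k) (w : List K) : 0 < wordScale c w := by
  induction w with
  | nil => simp [wordScale]
  | cons k w ih => exact mul_pos (hc k) ih

/-- The maps `x ↦ c k * x + a k` are increasing and send the unit interval into itself. -/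
def MapsUnit (c a : K → ℝ) : Prop := ∀ k, 0 < c k ∧ 0 ≤ a k ∧ a k + c k ≤ 1

theorem MapsUnit.word (h : MapsUnit c a) (w : List K) :
    0 ≤ wordShift c a w ∧ wordShift c a w + wordScale c w ≤ 1 := by
  induction w with
  | nil => simp [wordShift, wordScale]
  | cons k w ih =>
    obtain ⟨h1, h2, h3⟩ := h k
    simp only [wordShift, wordScale]
    constructor
    · have := mul_nonneg h1.le ih.1
      linarith
    · nlinarith [ih.2]

/-- The intervals `[a, a + c)` and `[a', a' + c')` are disjoint (for positive lengths). -/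
def Apart (a c a' c' : ℝ) : Prop := a + c ≤ a' ∨ a' + c' ≤ a

theorem Apart.cons {k l : K} (h : MapsUnit c a) (hkl : Apart (a k) (c k) (a l) (c l))
    (v w : List K) :
    Apart (wordShift c a (k :: v)) (wordScale c (k :: v))
      (wordShift c a (l :: w)) (wordScale c (l :: w)) := by
  obtain ⟨hv1, hv2⟩ := h.word v
  obtain ⟨hw1, hw2⟩ := h.word w
  have h1 := mul_le_mul_of_nonneg_left hv2 (h k).1.le
  have h2 := mul_le_mul_of_nonneg_left hw2 (h l).1.le
  have h3 := mul_nonneg (h k).1.le hv1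
  have h4 := mul_nonneg (h l).1.le hw1
  simp only [Apart, wordShift, wordScale] at *
  rcases hkl with hkl | hkl
  · left; linarith
  · right; linarith

theorem Apart.append {p : List K} (hc : ∀ k, 0 < c k) {v w : List K}
    (h : Apart (wordShift c a v) (wordScale c v) (wordShift c a w) (wordScale c w)) :
    Apart (wordShift c a (p ++ v)) (wordScale c (p ++ v))
      (wordShift c a (p ++ w)) (wordScale c (p ++ w)) := by
  have hp := (wordScale_pos hc p).le
  simp only [wordShift_append, wordScale_append]
  rcases h with h | h
  · left; linarith [mul_le_mul_of_nonneg_left h hp]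
  · right; linarith [mul_le_mul_of_nonneg_left h hp]

open scoped Classical in
/-- Complete prefix codes: finite sets of words such that every infinite word has exactly one
initial segment in the set. -/
inductive IsCut {K : Type*} [Fintype K] : Finset (List K) → Prop
  | nil : IsCut {[]}
  | node (V : K → Finset (List K)) : (∀ k, IsCut (V k)) →
      IsCut (Finset.univ.biUnion fun k => (V k).map ⟨List.cons k, List.cons_injective⟩)

variable [Fintype K]

/-- A multiplicative weight of total mass one has total mass one on each complete prefix code. -/
theorem IsCut.sum_eq_one {W : Finset (List K)} (hW : IsCut W) {p : K → ℝ}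
    (hp : ∑ k, p k = 1) : ∑ w ∈ W, wordScale p w = 1 := by
  classical
  induction hW with
  | nil => simp [wordScale]
  | node V _ ih =>
    rw [Finset.sum_biUnion]
    · simp only [Finset.sum_map, Function.Embedding.coeFn_mk, wordScale, ← Finset.mul_sum, ih,
        mul_one, hp]
    · intro k _ l _ hkl
      rw [Function.onFun, Finset.disjoint_left]
      rintro w hw hw'
      simp only [Finset.mem_map, Function.Embedding.coeFn_mk] at hw hw'
      obtain ⟨v, -, rfl⟩ := hw
      obtain ⟨v', -, h⟩ := hw'
      exact hkl (List.cons.inj h).1.symm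

/-- Distinct words of a prefix code have disjoint boxes, if distinct letters do. -/
theorem IsCut.apart {W : Finset (List K)} (hW : IsCut W) {d b : K → ℝ} (hc : MapsUnit c a)
    (hd : MapsUnit d b)
    (h : ∀ k l, k ≠ l → Apart (a k) (c k) (a l) (c l) ∨ Apart (b k) (d k) (b l) (d l))
    {v w : List K} (hv : v ∈ W) (hw : w ∈ W) (hvw : v ≠ w) :
    Apart (wordShift c a v) (wordScale c v) (wordShift c a w) (wordScale c w) ∨
      Apart (wordShift d b v) (wordScale d v) (wordShift d b w) (wordScale d w) := by
  induction hW generalizing v w with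
  | nil => simp_all
  | node V _ ih =>
    simp only [Finset.mem_biUnion, Finset.mem_univ, true_and, Finset.mem_map,
      Function.Embedding.coeFn_mk] at hv hw
    obtain ⟨k, v, hv, rfl⟩ := hv
    obtain ⟨l, w, hw, rfl⟩ := hw
    by_cases hkl : k = l
    · subst hkl
      have hne : v ≠ w := fun h => hvw (by rw [h])
      exact (ih k hv hw hne).imp (Apart.append (p := [k]) fun k => (hc k).1)
        (Apart.append (p := [k]) fun k => (hd k).1)
    · exact (h k l hkl).imp (fun h => h.cons hc v w) (fun h => h.cons hd v w)

theorem IsCut.apart_line {W : Finset (List K)} (hW : IsCut W) (hc : MapsUnit c a)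
    (h : ∀ k l, k ≠ l → Apart (a k) (c k) (a l) (c l))
    {v w : List K} (hv : v ∈ W) (hw : w ∈ W) (hvw : v ≠ w) :
    Apart (wordShift c a v) (wordScale c v) (wordShift c a w) (wordScale c w) :=
  or_self_iff.1 (hW.apart hc hc (fun k l hkl => Or.inl (h k l hkl)) hv hw hvw)

/-- A word is extended until the shorter side of its box, of the form `p * _` by `q * _`, is at most
`η`; the exponent `n` bounds the number of letters still needed. -/
theorem exists_cut_aux {d : K → ℝ} {κ l η : ℝ} (hκ : 0 < κ)
    (hη : 0 < η) (hc : ∀ k, κ ≤ c k ∧ c k ≤ l) (hd : ∀ k, κ ≤ d k ∧ d k ≤ l) (n : ℕ) :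
    ∀ p q : ℝ, κ * η ≤ min p q → min p q * l ^ n ≤ η →
      ∃ W : Finset (List K), IsCut W ∧ ∀ w ∈ W,
        κ * η ≤ min (p * wordScale c w) (q * wordScale d w) ∧
        min (p * wordScale c w) (q * wordScale d w) ≤ η := by
  classical
  induction n with
  | zero =>
    intro p q h1 h2
    exact ⟨_, IsCut.nil, by
      simpa [wordScale] using And.intro (by simpa using h1) (by simpa using h2)⟩
  | succ n ih =>
    intro p q h1 h2
    by_cases h : min p q ≤ η
    · exact ⟨_, IsCut.nil, by
        simpa [wordScale] using And.intro (by simpa using h1) (by simpa using h)⟩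
    push Not at h
    have hm : 0 < min p q := hη.trans h
    have hp : 0 < p := hm.trans_le (min_le_left _ _)
    have hq : 0 < q := hm.trans_le (min_le_right _ _)
    have key : ∀ k, ∃ W : Finset (List K), IsCut W ∧ ∀ w ∈ W,
        κ * η ≤ min (p * c k * wordScale c w) (q * d k * wordScale d w) ∧
        min (p * c k * wordScale c w) (q * d k * wordScale d w) ≤ η := by
      intro k
      have hl0 : 0 < l := hκ.trans_le ((hc k).1.trans (hc k).2)
      apply ih
      · have hpη : η ≤ p := h.le.trans (min_le_left _ _)
        have hqη : η ≤ q := h.le.trans (min_le_right _ _)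
        refine le_min ?_ ?_
        · rw [mul_comm κ]; exact mul_le_mul hpη (hc k).1 hκ.le hp.le
        · rw [mul_comm κ]; exact mul_le_mul hqη (hd k).1 hκ.le hq.le
      · refine le_trans ?_ h2
        rw [pow_succ', ← mul_assoc]
        refine mul_le_mul_of_nonneg_right ?_ (pow_pos hl0 n).le
        rw [min_mul_of_nonneg _ _ hl0.le]
        exact min_le_min (mul_le_mul_of_nonneg_left (hc k).2 hp.le)
          (mul_le_mul_of_nonneg_left (hd k).2 hq.le)
    choose V hV hV' using key
    refine ⟨_, IsCut.node V hV, ?_⟩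
    intro w hw
    simp only [Finset.mem_biUnion, Finset.mem_univ, true_and, Finset.mem_map,
      Function.Embedding.coeFn_mk] at hw
    obtain ⟨k, w, hw, rfl⟩ := hw
    simpa only [wordScale, mul_assoc] using hV' k w hw

/-- For each scale `η` there is a complete prefix code all of whose words have boxes with shorter
side comparable to `η`. -/
theorem exists_cut {d : K → ℝ} {κ l η : ℝ} (hκ : 0 < κ) (hκ1 : κ ≤ 1) (hl : l < 1)
    (hη : 0 < η) (hη1 : η ≤ 1) (hc : ∀ k, κ ≤ c k ∧ c k ≤ l) (hd : ∀ k, κ ≤ d k ∧ d k ≤ l) :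
    ∃ W : Finset (List K), IsCut W ∧ ∀ w ∈ W,
        κ * η ≤ min (wordScale c w) (wordScale d w) ∧
        min (wordScale c w) (wordScale d w) ≤ η := by
  obtain ⟨n, hn⟩ := exists_pow_lt_of_lt_one hη hl
  have := exists_cut_aux hκ hη hc hd n 1 1 (by simpa using mul_le_one₀ hκ1 hη.le hη1)
    (by simpa using hn.le)
  simpa using this

theorem exists_cut_line {κ l η : ℝ} (hκ : 0 < κ) (hκ1 : κ ≤ 1) (hl : l < 1)
    (hη : 0 < η) (hη1 : η ≤ 1) (hc : ∀ k, κ ≤ c k ∧ c k ≤ l) :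
    ∃ W : Finset (List K), IsCut W ∧ ∀ w ∈ W, κ * η ≤ wordScale c w ∧ wordScale c w ≤ η := by
  simpa using exists_cut hκ hκ1 hl hη hη1 hc hc

end Words

theorem exists_uniform_bounds {K : Type*} [Finite K] {c : K → ℝ} (hc : ∀ k, c k ∈ Ioo (0 : ℝ) 1) :
    ∃ κ l : ℝ, 0 < κ ∧ κ ≤ 1 ∧ 0 ≤ l ∧ l < 1 ∧ ∀ k, κ ≤ c k ∧ c k ≤ l := by
  cases nonempty_fintype K
  rcases isEmpty_or_nonempty K with hK | hK
  · exact ⟨1, 0, one_pos, le_rfl, le_rfl, one_pos, fun k => hK.elim k⟩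
  obtain ⟨i, hi⟩ := Finite.exists_min c
  obtain ⟨j, hj⟩ := Finite.exists_max c
  exact ⟨c i, c j, (hc i).1, (hc i).2.le, (hc j).1.le, (hc j).2, fun k => ⟨hi k, hj k⟩⟩

/-- An interval `[a, a + c)` of length at least `e` whose closure meets `[x - R, x + R]` contains
a multiple of `e` close to `x`. -/
theorem exists_multiple_mem {a c e x R z : ℝ} {L : ℕ} (he : 0 < e) (hc : e ≤ c) (hR : R ≤ L * e)
    (hz1 : a ≤ z) (hz2 : z ≤ a + c) (hz : |z - x| ≤ R) :
    ∃ n : ℤ, a ≤ (⌊x / e⌋ + n) * e ∧ (⌊x / e⌋ + n) * e < a + c ∧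
      n ∈ Finset.Icc (-(L + 1 : ℤ)) (L + 2) := by
  obtain ⟨hz3, hz4⟩ := abs_le.1 hz
  -- the half-open interval `[u, u + e)` lies in `[a, a + c)` and near `z`
  set u := max a (z - e) with hu
  have hua : a ≤ u := le_max_left _ _
  have huz : z - e ≤ u := le_max_right _ _
  have huc : u + e ≤ a + c := by
    rcases max_choice a (z - e) with h | h <;> rw [hu, h] <;> linarith
  have huz' : u ≤ z := max_le hz1 (by linarith)
  have h1 : u ≤ ⌈u / e⌉ * e := by
    rw [← div_le_iff₀ he]; exact Int.le_ceil _
  have h2 : ⌈u / e⌉ * e < u + e := by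
    have := mul_lt_mul_of_pos_right (Int.ceil_lt_add_one (u / e)) he
    rwa [add_mul, one_mul, div_mul_cancel₀ _ he.ne'] at this
  have h3 : (⌊x / e⌋ : ℝ) * e ≤ x := by
    rw [← le_div_iff₀ he]; exact Int.floor_le _
  have h4 : x < (⌊x / e⌋ : ℝ) * e + e := by
    have := mul_lt_mul_of_pos_right (Int.lt_floor_add_one (x / e)) he
    rwa [add_mul, one_mul, div_mul_cancel₀ _ he.ne'] at this
  refine ⟨⌈u / e⌉ - ⌊x / e⌋, ?_, ?_, ?_⟩
  · push_cast; rw [add_sub_cancel]; linarith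
  · push_cast; rw [add_sub_cancel]; linarith
  · rw [Finset.mem_Icc]
    constructor
    · have : (-(L + 1 : ℤ) : ℝ) * e ≤ ((⌈u / e⌉ : ℝ) - ⌊x / e⌋) * e := by push_cast; linarith
      exact_mod_cast le_of_mul_le_mul_right this he
    · have : ((⌈u / e⌉ : ℝ) - ⌊x / e⌋) * e ≤ ((L + 2 : ℤ) : ℝ) * e := by push_cast; linarith
      exact_mod_cast le_of_mul_le_mul_right this he

/-- A family of pairwise disjoint boxes with sides at least `e`, all meeting a square of
comparable size, has boundedly many members: distinct boxes contain distinct points of the lattice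
of mesh `e`. -/
theorem card_le_of_apart {ι : Type*} (W : Finset ι) {a c b d p q : ι → ℝ} {e x y R : ℝ} {L : ℕ}
    (he : 0 < e) (hR : R ≤ L * e) (hc : ∀ w ∈ W, e ≤ c w) (hd : ∀ w ∈ W, e ≤ d w)
    (hW : ∀ v ∈ W, ∀ w ∈ W, v ≠ w → Apart (a v) (c v) (a w) (c w) ∨ Apart (b v) (d v) (b w) (d w))
    (hp : ∀ w ∈ W, a w ≤ p w ∧ p w ≤ a w + c w ∧ |p w - x| ≤ R)
    (hq : ∀ w ∈ W, b w ≤ q w ∧ q w ≤ b w + d w ∧ |q w - y| ≤ R) :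
    W.card ≤ (2 * L + 4) ^ 2 := by
  have h1 : ∀ w ∈ W, ∃ n : ℤ, a w ≤ (⌊x / e⌋ + n) * e ∧ (⌊x / e⌋ + n) * e < a w + c w ∧
      n ∈ Finset.Icc (-(L + 1 : ℤ)) (L + 2) := fun w hw =>
    exists_multiple_mem he (hc w hw) hR (hp w hw).1 (hp w hw).2.1 (hp w hw).2.2
  have h2 : ∀ w ∈ W, ∃ n : ℤ, b w ≤ (⌊y / e⌋ + n) * e ∧ (⌊y / e⌋ + n) * e < b w + d w ∧
      n ∈ Finset.Icc (-(L + 1 : ℤ)) (L + 2) := fun w hw =>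
    exists_multiple_mem he (hd w hw) hR (hq w hw).1 (hq w hw).2.1 (hq w hw).2.2
  choose! m hm1 hm2 hm3 using h1
  choose! n hn1 hn2 hn3 using h2
  have hcard : (Finset.Icc (-(L + 1 : ℤ)) (L + 2) ×ˢ Finset.Icc (-(L + 1 : ℤ)) (L + 2)).card
      = (2 * L + 4) ^ 2 := by
    rw [Finset.card_product, Int.card_Icc, sq]
    congr 1 <;> omega
  rw [← hcard]
  refine Finset.card_le_card_of_injOn (fun w => (m w, n w)) ?_ ?_
  · intro w hw
    exact Finset.mem_product.2 ⟨hm3 w hw, hn3 w hw⟩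
  · intro v hv w hw hvw
    by_contra hne
    simp only [Prod.mk.injEq] at hvw
    have a1 := hm1 v hv
    have a2 := hm2 v hv
    have a3 := hm1 w hw
    have a4 := hm2 w hw
    have b1 := hn1 v hv
    have b2 := hn2 v hv
    have b3 := hn1 w hw
    have b4 := hn2 w hw
    rw [hvw.1] at a1 a2
    rw [hvw.2] at b1 b2
    rcases hW v hv w hw hne with (h | h) | (h | h) <;> linarith

theorem card_le_of_apart_line {ι : Type*} (W : Finset ι) {a c p : ι → ℝ} {e x R : ℝ} {L : ℕ}
    (he : 0 < e) (hR : R ≤ L * e) (hc : ∀ w ∈ W, e ≤ c w)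
    (hW : ∀ v ∈ W, ∀ w ∈ W, v ≠ w → Apart (a v) (c v) (a w) (c w))
    (hp : ∀ w ∈ W, a w ≤ p w ∧ p w ≤ a w + c w ∧ |p w - x| ≤ R) :
    W.card ≤ (2 * L + 4) ^ 2 :=
  card_le_of_apart W he hR hc hc (fun v hv w hw h => Or.inl (hW v hv w hw h)) hp hp

/-! ### Covering numbers -/

section CoverNumber

variable {X Y : Type*} [PseudoMetricSpace X] [PseudoMetricSpace Y]

/-- A finite cover by sets of diameter at most `r / 2` can be fattened to an open cover. -/
theorem openCoverNumber_le {ι : Type*} {r : ℝ} (hr : 0 < r) {A : Set X} (P : Finset ι)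
    (U : ι → Set X) (hA : A ⊆ ⋃ i ∈ P, U i)
    (hU : ∀ i ∈ P, ∀ p ∈ U i, ∀ q ∈ U i, dist p q ≤ r / 2) :
    openCoverNumber r A ≤ P.card := by
  have hcov : A ⊆ ⋃₀ ((fun i => Metric.thickening (r / 4) (U i)) '' (P : Set ι)) := by
    intro x hx
    obtain ⟨i, hi, hxi⟩ := mem_iUnion₂.1 (hA hx)
    exact ⟨_, ⟨i, hi, rfl⟩, Metric.self_subset_thickening (by positivity) _ hxi⟩
  refine (iInf₂_le_of_le _ ?_ (iInf_le_of_le hcov ?_))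
  · rintro _ ⟨i, hi, rfl⟩
    refine ⟨Metric.isOpen_thickening, Metric.ediam_le ?_⟩
    intro p hp q hq
    obtain ⟨p', hp', hpp⟩ := Metric.mem_thickening_iff.1 hp
    obtain ⟨q', hq', hqq⟩ := Metric.mem_thickening_iff.1 hq
    rw [edist_dist]
    apply ENNReal.ofReal_le_ofReal
    have := hU i hi p' hp' q' hq'
    have h1 := dist_triangle4 p p' q' q
    rw [dist_comm q' q] at h1
    linarith
  · refine (Set.encard_image_le _ _).trans ?_
    rw [Set.encard_coe_eq_coe_finsetCard]

/-- A family of points of `A` of which few lie close together forces many covering sets. -/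
theorem card_le_mul_openCoverNumber {ι : Type*} {r : ℝ} (hr : 0 ≤ r) {A : Set X} (W : Finset ι)
    (f : ι → X) (hf : ∀ w ∈ W, f w ∈ A) (M : ℕ)
    (hM : ∀ v ∈ W, ∀ V ⊆ W, (∀ w ∈ V, dist (f w) (f v) ≤ r) → V.card ≤ M) :
    (W.card : ℕ∞) ≤ M * openCoverNumber r A := by
  classical
  rcases W.eq_empty_or_nonempty with rfl | ⟨v₀, hv₀⟩
  · simp
  have hM0 : M ≠ 0 := by
    have := hM v₀ hv₀ {v₀} (by simpa using hv₀) (by simpa using hr)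
    simp at this; omega
  have key : ∀ 𝒰 : Set (Set X), (∀ U ∈ 𝒰, IsOpen U ∧ Metric.ediam U ≤ ENNReal.ofReal r) →
      A ⊆ ⋃₀ 𝒰 → (W.card : ℕ∞) ≤ M * 𝒰.encard := by
    intro 𝒰 h𝒰 hA
    rcases 𝒰.finite_or_infinite with hfin | hinf
    · have hg : ∀ w ∈ W, ∃ U ∈ 𝒰, f w ∈ U := fun w hw => mem_sUnion.1 (hA (hf w hw))
      choose! g hg1 hg2 using hg
      rw [hfin.encard_eq_coe_toFinset_card]
      have := Finset.card_le_mul_card_image_of_maps_to (s := W) (t := hfin.toFinset) (f := g)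
        (fun w hw => by simpa using hg1 w hw) M ?_
      · exact_mod_cast this
      · intro U hU
        rcases (W.filter fun w => g w = U).eq_empty_or_nonempty with h | ⟨v, hv⟩
        · rw [h]; simp
        · rw [Finset.mem_filter] at hv
          refine hM v hv.1 _ (Finset.filter_subset _ _) ?_
          intro w hw
          rw [Finset.mem_filter] at hw
          have h1 := Metric.edist_le_ediam_of_mem (hw.2 ▸ hg2 w hw.1) (hv.2 ▸ hg2 v hv.1)
          have h2 := h1.trans (h𝒰 U (by simpa using hU)).2
          rw [edist_dist] at h2
          exact (ENNReal.ofReal_le_ofReal_iff hr).1 h2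
    · rw [hinf.encard_eq, ENat.mul_top (by exact_mod_cast hM0)]
      exact le_top
  rw [openCoverNumber]
  have hM0' : (M : ℕ∞) ≠ 0 := by exact_mod_cast hM0
  by_cases hne : ∃ 𝒰 : Set (Set X), (∀ U ∈ 𝒰, IsOpen U ∧ Metric.ediam U ≤ ENNReal.ofReal r) ∧
      A ⊆ ⋃₀ 𝒰
  · obtain ⟨𝒰₀, h1₀, h2₀⟩ := hne
    -- the infimum is attained, as `ℕ∞` is well-ordered
    obtain ⟨𝒰, hmem, hmin⟩ := WellFounded.has_min (InvImage.wf (fun 𝒰 : Set (Set X) => 𝒰.encard)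
      (wellFounded_lt (α := ℕ∞)))
      {𝒰 | (∀ U ∈ 𝒰, IsOpen U ∧ Metric.ediam U ≤ ENNReal.ofReal r) ∧ A ⊆ ⋃₀ 𝒰} ⟨𝒰₀, h1₀, h2₀⟩
    refine (key 𝒰 hmem.1 hmem.2).trans ?_
    gcongr
    exact le_iInf₂ fun 𝒱 h𝒱 => le_iInf fun hA => not_lt.1 (hmin 𝒱 ⟨h𝒱, hA⟩)
  · have : (⨅ (𝒰 : Set (Set X)) (_ : ∀ U ∈ 𝒰, IsOpen U ∧ Metric.ediam U ≤ ENNReal.ofReal r)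
        (_ : A ⊆ ⋃₀ 𝒰), 𝒰.encard) = ⊤ := by
      simp only [iInf_eq_top]
      intro 𝒰 h1 h2
      exact absurd ⟨𝒰, h1, h2⟩ hne
    rw [this, ENat.mul_top hM0']
    exact le_top

theorem openCoverNumber_image_le (e : X ≃ᵢ Y) (r : ℝ) (A : Set X) :
    openCoverNumber r (e '' A) ≤ openCoverNumber r A := by
  refine le_iInf₂ fun 𝒰 h𝒰 => le_iInf fun hA => ?_
  have hcov : e '' A ⊆ ⋃₀ ((fun U => e '' U) '' 𝒰) := by
    rintro _ ⟨x, hx, rfl⟩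
    obtain ⟨U, hU, hxU⟩ := hA hx
    exact ⟨_, ⟨U, hU, rfl⟩, x, hxU, rfl⟩
  refine iInf₂_le_of_le _ ?_ (iInf_le_of_le hcov (Set.encard_image_le _ _))
  rintro _ ⟨U, hU, rfl⟩
  exact ⟨e.toHomeomorph.isOpenMap _ (h𝒰 U hU).1, (e.isometry.ediam_image U).trans_le (h𝒰 U hU).2⟩

theorem openCoverNumber_image (e : X ≃ᵢ Y) (r : ℝ) (A : Set X) :
    openCoverNumber r (e '' A) = openCoverNumber r A := by
  refine le_antisymm (openCoverNumber_image_le e r A) ?_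
  have := openCoverNumber_image_le e.symm r (e '' A)
  rwa [← image_comp, e.symm_comp_self, image_id] at this

theorem HasBoxDim.image {A : Set X} {s : ℝ} (h : HasBoxDim A s) (e : X ≃ᵢ Y) :
    HasBoxDim (e '' A) s := by
  simpa only [HasBoxDim, lowerBoxDim, upperBoxDim, openCoverNumber_image] using h

theorem assouadDim_image (e : X ≃ᵢ Y) (A : Set X) : assouadDim (e '' A) = assouadDim A := by
  have h : ∀ x R, Metric.closedBall (e x) R ∩ e '' A = e '' (Metric.closedBall x R ∩ A) := by
    intro x R
    rw [image_inter e.injective, e.image_closedBall]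
  simp only [assouadDim, forall_mem_image, h, openCoverNumber_image]

/-- If the covering numbers of `A` are comparable to `r ^ (-s)`, then `A` has box dimension `s`. -/
theorem hasBoxDim_of_bounds {A : Set X} {s C₁ C₂ : ℝ} (h1 : 0 < C₁)
    (hlow : ∀ r, 0 < r → r < 1 →
      ENNReal.ofReal (C₁ * r ^ (-s)) ≤ ((openCoverNumber r A : ℕ∞) : ENNReal))
    (hupp : ∀ r, 0 < r → r < 1 →
      ((openCoverNumber r A : ℕ∞) : ENNReal) ≤ ENNReal.ofReal (C₂ * r ^ (-s))) :
    HasBoxDim A s := by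
  have hev : ∀ᶠ r : ℝ in 𝓝[>] 0, 0 < r ∧ r < 1 :=
    Ioo_mem_nhdsGT one_pos
  have hlog : Tendsto (fun r : ℝ => -Real.log r) (𝓝[>] 0) atTop :=
    tendsto_neg_atBot_atTop.comp Real.tendsto_log_nhdsGT_zero
  have hlim : ∀ C : ℝ, Tendsto (fun r : ℝ => Real.log C / (-Real.log r) + s) (𝓝[>] 0) (𝓝 s) := by
    intro C
    simpa using (hlog.const_div_atTop (Real.log C)).add_const s
  have hEq : ∀ C : ℝ, 0 < C → ∀ r : ℝ, 0 < r → r < 1 →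
      Real.log (C * r ^ (-s)) / (-Real.log r) = Real.log C / (-Real.log r) + s := by
    intro C hC r hr hr1
    have : Real.log r < 0 := Real.log_neg hr hr1
    rw [Real.log_mul hC.ne' (Real.rpow_pos_of_pos hr _).ne', Real.log_rpow hr, add_div]
    rw [neg_mul, neg_div_neg_eq, mul_div_cancel_right₀ _ this.ne]
  have ht : Tendsto (fun r : ℝ => ENNReal.log ((openCoverNumber r A : ℕ∞) : ENNReal)
      / ((-Real.log r : ℝ) : EReal)) (𝓝[>] 0) (𝓝 (s : EReal)) := by
    refine tendsto_of_tendsto_of_tendsto_of_le_of_le'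
      ((continuous_coe_real_ereal.tendsto s).comp (hlim C₁))
      ((continuous_coe_real_ereal.tendsto s).comp (hlim C₂)) ?_ ?_
    · filter_upwards [hev] with r ⟨hr, hr1⟩
      have hneg : Real.log r < 0 := Real.log_neg hr hr1
      simp only [Function.comp]
      rw [← hEq C₁ h1 r hr hr1, EReal.coe_div]
      refine EReal.div_le_div_right_of_nonneg (by exact_mod_cast (neg_pos.2 hneg).le) ?_
      rw [← ENNReal.log_ofReal_of_pos (mul_pos h1 (Real.rpow_pos_of_pos hr _))]
      exact ENNReal.log_monotone (hlow r hr hr1)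
    · filter_upwards [hev] with r ⟨hr, hr1⟩
      have hneg : Real.log r < 0 := Real.log_neg hr hr1
      have h2 : 0 < C₂ := by
        have := (hlow r hr hr1).trans (hupp r hr hr1)
        rw [ENNReal.ofReal_le_ofReal_iff'] at this
        have h3 := mul_pos h1 (Real.rpow_pos_of_pos hr (-s))
        rcases this with h | h
        · exact pos_of_mul_pos_left (h3.trans_le h) (Real.rpow_pos_of_pos hr _).le
        · linarith
      simp only [Function.comp]
      rw [← hEq C₂ h2 r hr hr1, EReal.coe_div]
      refine EReal.div_le_div_right_of_nonneg (by exact_mod_cast (neg_pos.2 hneg).le) ?_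
      rw [← ENNReal.log_ofReal_of_pos (mul_pos h2 (Real.rpow_pos_of_pos hr _))]
      exact ENNReal.log_monotone (hupp r hr hr1)
  exact ⟨ht.liminf_eq, ht.limsup_eq⟩

end CoverNumber

/-! ### Self-similar sets on the line -/

/-- Moran's equation `∑ c k ^ s = 1` has a non-negative solution. -/
theorem exists_moran_exponent {K : Type*} [Fintype K] [Nonempty K] {c : K → ℝ}
    (hc : ∀ k, c k ∈ Ioo (0 : ℝ) 1) : ∃ s : ℝ, 0 ≤ s ∧ ∑ k, c k ^ s = 1 := by
  have hcont : Continuous fun s : ℝ => ∑ k, c k ^ s :=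
    continuous_finsetSum _ fun k _ => Real.continuous_const_rpow (hc k).1.ne'
  have hlim : Tendsto (fun s : ℝ => ∑ k, c k ^ s) atTop (𝓝 0) := by
    have : Tendsto (fun s : ℝ => ∑ k, c k ^ s) atTop (𝓝 (∑ _k : K, 0)) :=
      tendsto_finsetSum _ fun k _ =>
        tendsto_rpow_atTop_of_base_lt_one _ (by linarith [(hc k).1]) (hc k).2
    simpa using this
  obtain ⟨B, hB0, hB⟩ := ((eventually_ge_atTop 0).and (hlim.eventually_lt_const one_pos)).exists
  have h0 : 1 ≤ ∑ k, c k ^ (0 : ℝ) := by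
    simp only [Real.rpow_zero, Finset.sum_const, nsmul_eq_mul, mul_one]
    exact_mod_cast Finset.card_pos.2 Finset.univ_nonempty
  obtain ⟨s, hs, hs'⟩ := intermediate_value_Icc' hB0 hcont.continuousOn ⟨hB.le, h0⟩
  exact ⟨s, hs.1, hs'⟩

section Line

variable {K : Type*}

theorem wordScale_rpow {c : K → ℝ} (hc : ∀ k, 0 < c k) (s : ℝ) (w : List K) :
    wordScale (fun k => c k ^ s) w = wordScale c w ^ s := by
  induction w with
  | nil => simp [wordScale]
  | cons k w ih => simp [wordScale, ih, Real.mul_rpow (hc k).le (wordScale_pos hc w).le]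

variable {c a : K → ℝ} {E : Set ℝ}

theorem word_mem (hE : E = ⋃ k, (fun x => c k * x + a k) '' E) (w : List K) {x : ℝ} (hx : x ∈ E) :
    wordScale c w * x + wordShift c a w ∈ E := by
  induction w with
  | nil => simpa [wordScale, wordShift] using hx
  | cons k w ih =>
    rw [hE]
    refine mem_iUnion.2 ⟨k, _, ih, ?_⟩
    simp only [wordScale, wordShift]
    ring

theorem IsCut.exists_line [Fintype K] {W : Finset (List K)} (hW : IsCut W)
    (hE : E = ⋃ k, (fun x => c k * x + a k) '' E) {x : ℝ} (hx : x ∈ E) :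
    ∃ w ∈ W, ∃ y ∈ E, x = wordScale c w * y + wordShift c a w := by
  induction hW generalizing x with
  | nil => exact ⟨[], by simp, x, hx, by simp [wordScale, wordShift]⟩
  | node V _ ih =>
    rw [hE] at hx
    obtain ⟨k, x', hx', rfl⟩ := mem_iUnion.1 hx
    obtain ⟨w, hw, y, hy, rfl⟩ := ih k hx'
    refine ⟨k :: w, ?_, y, hy, ?_⟩
    · simp only [Finset.mem_biUnion, Finset.mem_univ, true_and, Finset.mem_map]
      exact ⟨k, w, hw, rfl⟩
    · simp only [wordScale, wordShift]
      ring

variable [Fintype K] {s : ℝ}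

/-- A prefix code of words of ratio at least `η` has at most `η ^ (-s)` members. -/
theorem IsCut.card_le {W : Finset (List K)} (hW : IsCut W) (hc : ∀ k, 0 < c k) (hs0 : 0 ≤ s)
    (hs : ∑ k, c k ^ s = 1) {η : ℝ} (hη : 0 < η) (h : ∀ w ∈ W, η ≤ wordScale c w) :
    (W.card : ℝ) ≤ η ^ (-s) := by
  have h1 := hW.sum_eq_one hs
  rw [Real.rpow_neg hη.le, ← one_div, le_div_iff₀ (Real.rpow_pos_of_pos hη s), ← h1,
    ← nsmul_eq_mul]
  refine Finset.card_nsmul_le_sum _ _ _ fun w hw => ?_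
  rw [wordScale_rpow hc]
  exact Real.rpow_le_rpow hη.le (h w hw) hs0

/-- A prefix code of words of ratio at most `η` has at least `η ^ (-s)` members. -/
theorem IsCut.le_card {W : Finset (List K)} (hW : IsCut W) (hc : ∀ k, 0 < c k) (hs0 : 0 ≤ s)
    (hs : ∑ k, c k ^ s = 1) {η : ℝ} (hη : 0 < η) (h : ∀ w ∈ W, wordScale c w ≤ η) :
    η ^ (-s) ≤ W.card := by
  have h1 := hW.sum_eq_one hs
  rw [Real.rpow_neg hη.le, ← one_div, div_le_iff₀ (Real.rpow_pos_of_pos hη s), ← h1,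
    ← nsmul_eq_mul]
  refine Finset.sum_le_card_nsmul _ _ _ fun w hw => ?_
  rw [wordScale_rpow hc]
  exact Real.rpow_le_rpow (wordScale_pos hc w).le (h w hw) hs0

/-- A self-similar set is covered by `O(r ^ (-s))` intervals of length `r`. -/
theorem exists_line_cover (hc : ∀ k, c k ∈ Ioo (0 : ℝ) 1)
    (hE : E = ⋃ k, (fun x => c k * x + a k) '' E) (hE1 : E ⊆ Icc 0 1)
    (hs0 : 0 ≤ s) (hs : ∑ k, c k ^ s = 1) (B : ℝ) :
    ∃ C > 0, ∀ r, 0 < r → r ≤ B →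
      ∃ P : Finset ℝ, (P.card : ℝ) ≤ C * r ^ (-s) ∧ E ⊆ ⋃ p ∈ P, Icc p (p + r) := by
  classical
  obtain ⟨κ, l, hκ, hκ1, hl0, hl, hκl⟩ := exists_uniform_bounds hc
  have hB : 0 < max B 1 := lt_max_of_lt_right one_pos
  refine ⟨(κ / max B 1) ^ (-s), by positivity, fun r hr hrB => ?_⟩
  have hη : 0 < r / max B 1 := by positivity
  have hη1 : r / max B 1 ≤ 1 := by
    rw [div_le_one hB]; exact hrB.trans (le_max_left _ _)
  -- dividing by `max B 1` brings the scale down to the unit range of `exists_cut_line`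
  obtain ⟨W, hW, hWs⟩ := exists_cut_line hκ hκ1 hl hη hη1 hκl
  refine ⟨W.image (wordShift c a), ?_, ?_⟩
  · rw [← Real.mul_rpow (by positivity) hr.le, div_mul_eq_mul_div, mul_div_assoc]
    exact (Nat.cast_le.2 Finset.card_image_le).trans
      (hW.card_le (fun k => (hc k).1) hs0 hs (by positivity) fun w hw => (hWs w hw).1)
  · intro x hx
    obtain ⟨w, hw, y, hy, rfl⟩ := hW.exists_line hE hx
    refine mem_iUnion₂.2 ⟨_, Finset.mem_image_of_mem _ hw, ?_⟩
    have hp := wordScale_pos (fun k => (hc k).1) w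
    have h1 := (hWs w hw).2
    have h2 : r / max B 1 ≤ r := div_le_self hr.le (le_max_right _ _)
    obtain ⟨hy0, hy1⟩ := hE1 hy
    constructor <;> nlinarith

/-- A self-similar set with separated cylinders contains `r ^ (-s)` points, boundedly many of
which lie in each interval of length comparable to `r`. -/
theorem exists_line_points (hc : ∀ k, c k ∈ Ioo (0 : ℝ) 1) (hca : MapsUnit c a)
    (hsep : ∀ k l, k ≠ l → Apart (a k) (c k) (a l) (c l))
    (hE : E = ⋃ k, (fun x => c k * x + a k) '' E) (hE0 : E.Nonempty) (hE1 : E ⊆ Icc 0 1)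
    (hs0 : 0 ≤ s) (hs : ∑ k, c k ^ s = 1) :
    ∃ M : ℕ, ∀ r : ℝ, 0 < r → r ≤ 1 → ∃ (W : Finset (List K)) (f : List K → ℝ),
      r ^ (-s) ≤ W.card ∧ (∀ w ∈ W, f w ∈ E) ∧
      ∀ x, ∀ V ⊆ W, (∀ w ∈ V, |f w - x| ≤ r) → V.card ≤ M := by
  obtain ⟨κ, l, hκ, hκ1, hl0, hl, hκl⟩ := exists_uniform_bounds hc
  obtain ⟨z, hz⟩ := hE0
  refine ⟨(2 * ⌈1 / κ⌉₊ + 4) ^ 2, fun r hr hr1 => ?_⟩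
  obtain ⟨W, hW, hWs⟩ := exists_cut_line hκ hκ1 hl hr hr1 hκl
  refine ⟨W, fun w => wordScale c w * z + wordShift c a w,
    hW.le_card (fun k => (hc k).1) hs0 hs hr fun w hw => (hWs w hw).2,
    fun w _ => word_mem hE w hz, ?_⟩
  intro x V hV hx
  refine card_le_of_apart_line (e := κ * r) (R := r) (x := x) V (by positivity) ?_
    (fun w hw => (hWs w (hV hw)).1)
    (fun v hv w hw => hW.apart_line hca hsep (hV hv) (hV hw))
    (p := fun w => wordScale c w * z + wordShift c a w) ?_
  · rw [← mul_assoc]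
    refine le_mul_of_one_le_left hr.le ?_
    rw [← div_le_iff₀ hκ]
    exact Nat.le_ceil _
  · intro w hw
    have hp := wordScale_pos (fun k => (hc k).1) w
    obtain ⟨hz0, hz1⟩ := hE1 hz
    refine ⟨?_, ?_, hx w hw⟩ <;> nlinarith

/-- A set isometric to a self-similar subset of the line with separated cylinders has the box
dimension given by Moran's equation. -/
theorem hasBoxDim_of_line {X : Type*} [PseudoMetricSpace X] {A : Set X} (π : X → ℝ)
    (hπ : ∀ p ∈ A, ∀ q ∈ A, dist p q = |π p - π q|)
    (hc : ∀ k, c k ∈ Ioo (0 : ℝ) 1) (hca : MapsUnit c a)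
    (hsep : ∀ k l, k ≠ l → Apart (a k) (c k) (a l) (c l))
    (hE : π '' A = ⋃ k, (fun x => c k * x + a k) '' (π '' A)) (hE0 : A.Nonempty)
    (hE1 : π '' A ⊆ Icc 0 1) (hs0 : 0 ≤ s) (hs : ∑ k, c k ^ s = 1) : HasBoxDim A s := by
  obtain ⟨C, hC, hcov⟩ := exists_line_cover hc hE hE1 hs0 hs 1
  obtain ⟨M, hpts⟩ := exists_line_points hc hca hsep hE (hE0.image _) hE1 hs0 hs
  refine hasBoxDim_of_bounds (C₁ := 1 / (M + 1)) (C₂ := C * (1 / 2) ^ (-s)) (by positivity)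
    (fun r hr hr1 => ?_) (fun r hr hr1 => ?_)
  · obtain ⟨W, f, hcard, hf, hV⟩ := hpts r hr hr1.le
    have hg : ∀ w ∈ W, ∃ p ∈ A, π p = f w := fun w hw => hf w hw
    have : Nonempty X := ⟨hE0.some⟩
    choose! g hg1 hg2 using hg
    have h1 := card_le_mul_openCoverNumber hr.le W g hg1 M (A := A) ?_
    · rcases eq_or_ne (openCoverNumber r A) ⊤ with htop | htop
      · simp [htop]
      · lift openCoverNumber r A to ℕ using htop with n
        have h2 : W.card ≤ M * n := by exact_mod_cast h1
        have h3 : (W.card : ℝ) ≤ M * n := by exact_mod_cast h2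
        have h4 : (1 : ℝ) / (M + 1) * r ^ (-s) ≤ n := by
          rw [div_mul_eq_mul_div, one_mul, div_le_iff₀ (by positivity)]
          nlinarith [(Nat.cast_nonneg n : (0 : ℝ) ≤ n)]
        refine (ENNReal.ofReal_le_ofReal h4).trans ?_
        simp
    · intro v hv V hVW h
      refine hV (f v) V hVW fun w hw => ?_
      rw [← hg2 w (hVW hw), ← hg2 v hv, ← hπ _ (hg1 w (hVW hw)) _ (hg1 v hv)]
      exact h w hw
  · obtain ⟨P, hP, hPE⟩ := hcov (r / 2) (by positivity) (by linarith)
    have h1 := openCoverNumber_le hr (A := A) P (fun p => {q ∈ A | π q ∈ Icc p (p + r / 2)}) ?_ ?_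
    · have h2 : ((openCoverNumber r A : ℕ∞) : ENNReal) ≤ ((P.card : ℕ∞) : ENNReal) := by
        exact_mod_cast h1
      refine h2.trans ?_
      rw [mul_assoc, ← Real.mul_rpow (by norm_num) hr.le, one_div_mul_eq_div]
      refine le_trans ?_ (ENNReal.ofReal_le_ofReal hP)
      simp
    · intro q hq
      obtain ⟨p, hp, hqp⟩ := mem_iUnion₂.1 (hPE (mem_image_of_mem π hq))
      exact mem_iUnion₂.2 ⟨p, hp, hq, hqp⟩
    · rintro p - q ⟨hq, hq1, hq2⟩ q' ⟨hq', hq1', hq2'⟩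
      rw [hπ q hq q' hq', abs_le]
      constructor <;> linarith

end Line

/-! ### Systems arranged in columns -/

namespace DiagonalIFS

variable {I K : Type*} {S : DiagonalIFS I} {F : Set (EuclideanSpace ℝ (Fin 2))}

@[simp] theorem map_zero (S : DiagonalIFS I) (i : I) (p : EuclideanSpace ℝ (Fin 2)) :
    S.map i p 0 = S.c i * p 0 + S.a i := by simp [map]

@[simp] theorem map_one (S : DiagonalIFS I) (i : I) (p : EuclideanSpace ℝ (Fin 2)) :
    S.map i p 1 = S.d i * p 1 + S.b i := by simp [map]

/-- The composition `S_{i₁} ∘ ⋯ ∘ S_{iₙ}` coded by a word. -/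
def wordMap (S : DiagonalIFS I) (w : List I) (p : EuclideanSpace ℝ (Fin 2)) :
    EuclideanSpace ℝ (Fin 2) := w.foldr S.map p

theorem wordMap_zero (w : List I) (p : EuclideanSpace ℝ (Fin 2)) :
    S.wordMap w p 0 = wordScale S.c w * p 0 + wordShift S.c S.a w := by
  induction w with
  | nil => simp [wordMap, wordScale, wordShift]
  | cons i w ih =>
    rw [wordMap, List.foldr_cons, map_zero, ← wordMap, ih, wordScale, wordShift]
    ring

theorem wordMap_one (w : List I) (p : EuclideanSpace ℝ (Fin 2)) :
    S.wordMap w p 1 = wordScale S.d w * p 1 + wordShift S.d S.b w := by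
  induction w with
  | nil => simp [wordMap, wordScale, wordShift]
  | cons i w ih =>
    rw [wordMap, List.foldr_cons, map_one, ← wordMap, ih, wordScale, wordShift]
    ring

theorem IsAttractor.map_mem (hF : S.IsAttractor F) (i : I) {p : EuclideanSpace ℝ (Fin 2)}
    (hp : p ∈ F) : S.map i p ∈ F := by
  rw [hF.2.2]
  exact mem_iUnion.2 ⟨i, p, hp, rfl⟩

theorem IsAttractor.exists_map (hF : S.IsAttractor F) {p : EuclideanSpace ℝ (Fin 2)}
    (hp : p ∈ F) : ∃ i, ∃ q ∈ F, S.map i q = p := by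
  rw [hF.2.2] at hp
  exact mem_iUnion.1 hp

theorem IsAttractor.wordMap_mem (hF : S.IsAttractor F) (w : List I)
    {p : EuclideanSpace ℝ (Fin 2)} (hp : p ∈ F) : S.wordMap w p ∈ F := by
  induction w with
  | nil => exact hp
  | cons i w ih => exact hF.map_mem i ih

theorem IsAttractor.exists_wordMap [Fintype I] (hF : S.IsAttractor F) {W : Finset (List I)}
    (hW : IsCut W) {p : EuclideanSpace ℝ (Fin 2)} (hp : p ∈ F) :
    ∃ w ∈ W, ∃ q ∈ F, S.wordMap w q = p := by
  induction hW generalizing p with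
  | nil => exact ⟨[], by simp, p, hp, rfl⟩
  | node V _ ih =>
    obtain ⟨i, p', hp', rfl⟩ := hF.exists_map hp
    obtain ⟨w, hw, q, hq, rfl⟩ := ih i hp'
    refine ⟨i :: w, ?_, q, hq, rfl⟩
    simp only [Finset.mem_biUnion, Finset.mem_univ, true_and, Finset.mem_map]
    exact ⟨i, w, hw, rfl⟩

/-- The attractor contains the fixed points: the point of `F` closest to the fixed point of `S_i`
would otherwise be moved closer to it by `S_i`. -/
theorem IsAttractor.fixedPoint_mem (hF : S.IsAttractor F) (i : I) : S.fixedPoint i ∈ F := by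
  obtain ⟨z, hz, hmin⟩ := hF.2.1.exists_isMinOn hF.1
    (f := fun p => (p 0 - S.fixedPoint i 0) ^ 2 + (p 1 - S.fixedPoint i 1) ^ 2)
    (by fun_prop)
  have hfix : S.map i (S.fixedPoint i) = S.fixedPoint i := (S.isFixedPt_map_iff i _).2 rfl
  have h0 := congrArg (fun p => p 0) hfix
  have h1 := congrArg (fun p => p 1) hfix
  simp only [map_zero, map_one] at h0 h1
  have h := isMinOn_iff.1 hmin _ (hF.map_mem i hz)
  simp only [map_zero, map_one] at h
  obtain ⟨hc0, hc1⟩ := S.c_mem i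
  obtain ⟨hd0, hd1⟩ := S.d_mem i
  set x := S.fixedPoint i 0
  set y := S.fixedPoint i 1
  have e0 : S.c i * z 0 + S.a i - x = S.c i * (z 0 - x) := by linarith
  have e1 : S.d i * z 1 + S.b i - y = S.d i * (z 1 - y) := by linarith
  rw [e0, e1] at h
  have hc2 : 0 < 1 - S.c i ^ 2 := by nlinarith
  have hd2 : 0 < 1 - S.d i ^ 2 := by nlinarith
  have k0 := mul_nonneg hc2.le (sq_nonneg (z 0 - x))
  have k1 := mul_nonneg hd2.le (sq_nonneg (z 1 - y))
  have hx : (z 0 - x) ^ 2 = 0 := by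
    have : (1 - S.c i ^ 2) * (z 0 - x) ^ 2 = 0 := by nlinarith
    exact (mul_eq_zero.1 this).resolve_left hc2.ne'
  have hy : (z 1 - y) ^ 2 = 0 := by
    have : (1 - S.d i ^ 2) * (z 1 - y) ^ 2 = 0 := by nlinarith
    exact (mul_eq_zero.1 this).resolve_left hd2.ne'
  have hzx : z = S.fixedPoint i := by
    rw [PiLp.ext_iff, Fin.forall_fin_two]
    exact ⟨sub_eq_zero.1 (pow_eq_zero_iff two_ne_zero |>.1 hx),
      sub_eq_zero.1 (pow_eq_zero_iff two_ne_zero |>.1 hy)⟩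
  exact hzx ▸ hz

theorem IsAttractor.mem_Icc_zero (hF : S.IsAttractor F) (h : MapsUnit S.c S.a)
    {p : EuclideanSpace ℝ (Fin 2)} (hp : p ∈ F) : p 0 ∈ Icc (0 : ℝ) 1 := by
  have hcont : ContinuousOn (fun p : EuclideanSpace ℝ (Fin 2) => p 0) F := by fun_prop
  obtain ⟨z, hz, hmin⟩ := hF.2.1.exists_isMinOn hF.1 hcont
  obtain ⟨y, hy, hmax⟩ := hF.2.1.exists_isMaxOn hF.1 hcont
  have hlow : z 0 ≤ p 0 := hmin hp
  have hupp : p 0 ≤ y 0 := hmax hp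
  obtain ⟨i, z', hz', rfl⟩ := hF.exists_map hz
  obtain ⟨j, y', hy', rfl⟩ := hF.exists_map hy
  have h1 : S.map i z' 0 ≤ z' 0 := hmin hz'
  have h2 : y' 0 ≤ S.map j y' 0 := hmax hy'
  simp only [map_zero] at *
  obtain ⟨hi1, hi2, hi3⟩ := h i
  obtain ⟨hj1, hj2, hj3⟩ := h j
  have hci := (S.c_mem i).2
  have hcj := (S.c_mem j).2
  constructor
  · refine le_trans ?_ hlow
    by_contra hneg
    push Not at hneg
    nlinarith
  · refine hupp.trans ?_
    by_contra hneg
    push Not at hneg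
    nlinarith

end DiagonalIFS

/-- The interchange of the coordinates of the plane. -/
noncomputable def swapPlane : EuclideanSpace ℝ (Fin 2) ≃ᵢ EuclideanSpace ℝ (Fin 2) :=
  (LinearIsometryEquiv.piLpCongrLeft 2 ℝ ℝ (Equiv.swap (0 : Fin 2) 1)).toIsometryEquiv

@[simp] theorem swapPlane_zero (p : EuclideanSpace ℝ (Fin 2)) : swapPlane p 0 = p 1 := by
  simp [swapPlane, LinearIsometryEquiv.piLpCongrLeft_apply, Equiv.piCongrLeft'_apply]

@[simp] theorem swapPlane_one (p : EuclideanSpace ℝ (Fin 2)) : swapPlane p 1 = p 0 := by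
  simp [swapPlane, LinearIsometryEquiv.piLpCongrLeft_apply, Equiv.piCongrLeft'_apply]

@[simp] theorem swapPlane_swapPlane (p : EuclideanSpace ℝ (Fin 2)) :
    swapPlane (swapPlane p) = p := by
  rw [PiLp.ext_iff, Fin.forall_fin_two]
  simp

namespace DiagonalIFS

variable {I K : Type*} {S : DiagonalIFS I} {F : Set (EuclideanSpace ℝ (Fin 2))}

theorem swap_map (i : I) (p : EuclideanSpace ℝ (Fin 2)) :
    S.swap.map i (swapPlane p) = swapPlane (S.map i p) := by
  rw [PiLp.ext_iff, Fin.forall_fin_two]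
  simp [swap]

theorem IsAttractor.swap (hF : S.IsAttractor F) : S.swap.IsAttractor (swapPlane '' F) := by
  refine ⟨hF.1.image _, hF.2.1.image swapPlane.continuous, ?_⟩
  conv_lhs => rw [hF.2.2]
  simp only [image_iUnion, image_image, swap_map]

theorem IsAttractor.mem_Icc_one (hF : S.IsAttractor F) (h : MapsUnit S.d S.b)
    {p : EuclideanSpace ℝ (Fin 2)} (hp : p ∈ F) : p 1 ∈ Icc (0 : ℝ) 1 := by
  simpa using hF.swap.mem_Icc_zero (S := S.swap) h (mem_image_of_mem swapPlane hp)

theorem axisProj_swapPlane_zero (F : Set (EuclideanSpace ℝ (Fin 2))) :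
    axisProj 0 (swapPlane '' F) = axisProj 1 F := by
  simp [axisProj, image_image]

theorem slice_swap_zero (S : DiagonalIFS I) (F : Set (EuclideanSpace ℝ (Fin 2))) (i : I) :
    S.swap.slice (swapPlane '' F) 0 i = swapPlane '' S.slice F 1 i := by
  ext p
  constructor
  · rintro ⟨⟨q, hq, rfl⟩, h⟩
    exact ⟨q, ⟨hq, by simpa [fixedPoint, swap] using h⟩, rfl⟩
  · rintro ⟨q, ⟨hq, h⟩, rfl⟩
    exact ⟨⟨q, hq, rfl⟩, by simpa [fixedPoint, swap] using h⟩

/-- An arrangement of the maps of the system in columns, indexed by `K`, such that maps in the same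
column have the same horizontal part. The images of the unit square lie in the unit square, distinct
columns do not overlap, and neither do distinct images in the same column. Each column contains an
image. -/
structure Columns (S : DiagonalIFS I) (K : Type*) where
  col : I → K
  width : K → ℝ
  left : K → ℝ
  col_surjective : Function.Surjective col
  width_col : ∀ i, width (col i) = S.c i
  left_col : ∀ i, left (col i) = S.a i
  mapsUnit_fst : MapsUnit S.c S.a
  mapsUnit_snd : MapsUnit S.d S.b
  apart_columns : ∀ k l, k ≠ l → Apart (left k) (width k) (left l) (width l)
  apart_of_col_eq : ∀ i j, i ≠ j → col i = col j → Apart (S.b i) (S.d i) (S.b j) (S.d j)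

namespace Columns

theorem width_mem (T : S.Columns K) (k : K) : T.width k ∈ Ioo (0 : ℝ) 1 := by
  obtain ⟨i, rfl⟩ := T.col_surjective k
  rw [T.width_col]
  exact S.c_mem i

theorem mapsUnit_width (T : S.Columns K) : MapsUnit T.width T.left := by
  intro k
  obtain ⟨i, rfl⟩ := T.col_surjective k
  rw [T.width_col, T.left_col]
  exact T.mapsUnit_fst i

theorem apart (T : S.Columns K) (i j : I) (hij : i ≠ j) :
    Apart (S.a i) (S.c i) (S.a j) (S.c j) ∨ Apart (S.b i) (S.d i) (S.b j) (S.d j) := by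
  by_cases h : T.col i = T.col j
  · exact Or.inr (T.apart_of_col_eq i j hij h)
  · left
    rw [← T.width_col, ← T.width_col, ← T.left_col, ← T.left_col]
    exact T.apart_columns _ _ h

theorem wordScale_map_col (T : S.Columns K) (w : List I) :
    wordScale T.width (w.map T.col) = wordScale S.c w := by
  simp only [wordScale_map, T.width_col]

theorem wordShift_map_col (T : S.Columns K) (w : List I) :
    wordShift T.width T.left (w.map T.col) = wordShift S.c S.a w := by
  simp only [wordShift_map, T.width_col, T.left_col]

theorem axisProj_eq (T : S.Columns K) (hF : S.IsAttractor F) :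
    axisProj 0 F = ⋃ k, (fun x => T.width k * x + T.left k) '' axisProj 0 F := by
  ext x
  simp only [axisProj, mem_iUnion, mem_image, exists_exists_and_eq_and]
  constructor
  · rintro ⟨p, hp, rfl⟩
    obtain ⟨i, q, hq, rfl⟩ := hF.exists_map hp
    exact ⟨T.col i, q, hq, by simp [T.width_col, T.left_col]⟩
  · rintro ⟨k, q, hq, rfl⟩
    obtain ⟨i, rfl⟩ := T.col_surjective k
    exact ⟨S.map i q, hF.map_mem i hq, by simp [T.width_col, T.left_col]⟩

theorem axisProj_subset (T : S.Columns K) (hF : S.IsAttractor F) : axisProj 0 F ⊆ Icc 0 1 := by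
  rintro _ ⟨p, hp, rfl⟩
  exact hF.mem_Icc_zero T.mapsUnit_fst hp

theorem hasBoxDim_axisProj [Fintype K] (T : S.Columns K) (hF : S.IsAttractor F) {s : ℝ}
    (hs0 : 0 ≤ s) (hs : ∑ k, T.width k ^ s = 1) : HasBoxDim (axisProj 0 F) s := by
  refine hasBoxDim_of_line id (fun p _ q _ => Real.dist_eq p q) T.width_mem T.mapsUnit_width
    T.apart_columns ?_ (hF.1.image _) ?_ hs0 hs
  · rw [image_id]; exact T.axisProj_eq hF
  · rw [image_id]; exact T.axisProj_subset hF

/-- The vertical line through the fixed point of `S_i` meets no column other than that of `i`: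
the fixed point lies on the boundary of its column only if that is the boundary of the square. -/
theorem col_eq_of_map_zero_eq (T : S.Columns K) (hF : S.IsAttractor F) {i j : I}
    {q : EuclideanSpace ℝ (Fin 2)} (hq : q ∈ F) (h : S.map j q 0 = S.fixedPoint i 0) :
    T.col j = T.col i := by
  by_contra hne
  have hfix : S.map i (S.fixedPoint i) = S.fixedPoint i := (S.isFixedPt_map_iff i _).2 rfl
  have h0 := congrArg (fun p => p 0) hfix
  have hx := hF.mem_Icc_zero T.mapsUnit_fst (hF.fixedPoint_mem i)
  have hq' := hF.mem_Icc_zero T.mapsUnit_fst hq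
  simp only [map_zero] at h h0
  have hsep := T.apart_columns _ _ hne
  rw [T.width_col, T.width_col, T.left_col, T.left_col] at hsep
  obtain ⟨hi1, hi2, hi3⟩ := T.mapsUnit_fst i
  obtain ⟨hj1, hj2, hj3⟩ := T.mapsUnit_fst j
  obtain ⟨hx0, hx1⟩ := hx
  obtain ⟨hq0, hq1⟩ := hq'
  have k1 := mul_le_mul_of_nonneg_left hq1 hj1.le
  have k2 := mul_nonneg hj1.le hq0
  have k3 := mul_nonneg hi1.le hx0
  have k4 := mul_le_mul_of_nonneg_left hx1 hi1.le
  rcases hsep with hsep | hsep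
  · have : S.c i * S.fixedPoint i 0 = 0 := by linarith
    have hz : S.fixedPoint i 0 = 0 := (mul_eq_zero.1 this).resolve_left hi1.ne'
    linarith
  · have : S.c i * (1 - S.fixedPoint i 0) = 0 := by linarith
    have hz := (mul_eq_zero.1 this).resolve_left hi1.ne'
    linarith

theorem slice_image_eq (T : S.Columns K) (hF : S.IsAttractor F) (i : I) :
    (fun p => p 1) '' S.slice F 0 i = ⋃ j : {j // T.col j = T.col i},
      (fun y => S.d j * y + S.b j) '' ((fun p => p 1) '' S.slice F 0 i) := by
  have hfix : S.map i (S.fixedPoint i) = S.fixedPoint i := (S.isFixedPt_map_iff i _).2 rfl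
  have h0 := congrArg (fun p => p 0) hfix
  simp only [map_zero] at h0
  have hcol : ∀ j, T.col j = T.col i → S.c j = S.c i ∧ S.a j = S.a i := by
    intro j hj
    rw [← T.width_col, ← T.left_col, hj, T.width_col, T.left_col]
    exact ⟨rfl, rfl⟩
  ext y
  simp only [mem_iUnion, mem_image, exists_exists_and_eq_and, Subtype.exists]
  constructor
  · rintro ⟨p, ⟨hp, hp0⟩, rfl⟩
    obtain ⟨j, q, hq, rfl⟩ := hF.exists_map hp
    have hj := T.col_eq_of_map_zero_eq hF hq hp0
    refine ⟨j, hj, q, ⟨hq, ?_⟩, by simp⟩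
    obtain ⟨h1, h2⟩ := hcol j hj
    rw [map_zero, h1, h2, ← h0] at hp0
    exact mul_left_cancel₀ (S.c_mem i).1.ne' (add_right_cancel hp0)
  · rintro ⟨j, hj, q, ⟨hq, hq0⟩, rfl⟩
    obtain ⟨h1, h2⟩ := hcol j hj
    exact ⟨S.map j q, ⟨hF.map_mem j hq, by rw [map_zero, h1, h2, hq0, h0]⟩, by simp⟩

theorem hasBoxDim_slice [Fintype I] [DecidableEq K] (T : S.Columns K) (hF : S.IsAttractor F)
    (i : I) {t : ℝ} (ht0 : 0 ≤ t) (ht : ∑ j : {j // T.col j = T.col i}, S.d j ^ t = 1) :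
    HasBoxDim (S.slice F 0 i) t := by
  refine hasBoxDim_of_line (K := {j // T.col j = T.col i}) (c := fun j => S.d j)
    (a := fun j => S.b j) (fun p => p 1) ?_ (fun j => S.d_mem j)
    (fun j => T.mapsUnit_snd j) ?_ (T.slice_image_eq hF i)
    ⟨_, hF.fixedPoint_mem i, rfl⟩ ?_ ht0 ht
  · rintro p ⟨-, hp⟩ q ⟨-, hq⟩
    simp [EuclideanSpace.dist_eq, Fin.sum_univ_two, hp, hq, Real.dist_eq, Real.sqrt_sq_eq_abs]
  · intro j l hjl
    exact T.apart_of_col_eq j l (fun h => hjl (Subtype.ext h)) (j.2.trans l.2.symm)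
  · rintro _ ⟨p, ⟨hp, -⟩, rfl⟩
    exact hF.mem_Icc_one T.mapsUnit_snd hp

end Columns

end DiagonalIFS

/-! ### The lower bound for the Assouad dimension -/

theorem abs_sub_apply_le_dist (p q : EuclideanSpace ℝ (Fin 2)) (i : Fin 2) :
    |p i - q i| ≤ dist p q := by
  rw [dist_eq_norm]
  exact PiLp.norm_apply_le (p - q) i

theorem dist_le_abs_add_abs (p q : EuclideanSpace ℝ (Fin 2)) :
    dist p q ≤ |p 0 - q 0| + |p 1 - q 1| := by
  rw [EuclideanSpace.dist_eq, Fin.sum_univ_two, Real.dist_eq, Real.dist_eq]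
  apply Real.sqrt_le_iff.2
  constructor
  · positivity
  · nlinarith [mul_nonneg (abs_nonneg (p 0 - q 0)) (abs_nonneg (p 1 - q 1))]

theorem affine_mem_Icc {a c y : ℝ} (hc : 0 ≤ c) (hy : y ∈ Icc (0 : ℝ) 1) :
    a ≤ c * y + a ∧ c * y + a ≤ a + c := by
  have h1 := mul_nonneg hc hy.1
  have h2 := mul_le_mul_of_nonneg_left hy.2 hc
  constructor <;> linarith

theorem abs_affine_sub_le {a c y y' R : ℝ} (hc : 0 ≤ c) (hR : c ≤ R) (hy : y ∈ Icc (0 : ℝ) 1)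
    (hy' : y' ∈ Icc (0 : ℝ) 1) : |c * y + a - (c * y' + a)| ≤ R := by
  obtain ⟨h1, h2⟩ := affine_mem_Icc (a := a) hc hy
  obtain ⟨h3, h4⟩ := affine_mem_Icc (a := a) hc hy'
  rw [abs_le]
  constructor <;> linarith

namespace DiagonalIFS

variable {I K : Type*} {S : DiagonalIFS I} {F : Set (EuclideanSpace ℝ (Fin 2))}

theorem wordMap_append (v w : List I) (p : EuclideanSpace ℝ (Fin 2)) :
    S.wordMap (v ++ w) p = S.wordMap v (S.wordMap w p) := List.foldr_append

namespace Columns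

/-- Points of a carpet which are as numerous as the lower bound for the Assouad dimension demands.
After `n` letters `j` with `S.d j < S.c j`, the image of the square is a rectangle of height
`R = S.d j ^ n`, much wider than high. It is cut down to width about `R` by prescribing a number `m`
of further columns, all of them equal to `k`; as `m` is large with `n`, the first of these
letters can be chosen freely in this column, down to height `ρ * R`, and the columns that
follow them can be chosen freely, down to width about `ρ * R`. -/
theorem exists_many_points [Fintype I] [Fintype K] [DecidableEq K] (T : S.Columns K)
    (hF : S.IsAttractor F) {s : ℝ} (hs0 : 0 ≤ s) (hs : ∑ k, T.width k ^ s = 1)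
    {j : I} (hj : S.d j < S.c j) (k : K) {t : ℝ} (ht0 : 0 ≤ t)
    (ht : ∑ i : {i // T.col i = k}, S.d i ^ t = 1) :
    ∃ M : ℕ, ∀ ρ : ℝ, 0 < ρ → ρ < 1 → ∀ ε > 0, ∃ R : ℝ, 0 < R ∧ R ≤ ε ∧ ∃ x ∈ F, ∃ n : ℕ,
      ρ ^ (-(s + t)) ≤ n ∧
      (n : ℕ∞) ≤ M * openCoverNumber (ρ * R) (Metric.closedBall x (2 * R) ∩ F) := by
  classical
  obtain ⟨κ, l, hκ, hκ1, -, hl, hκl⟩ := exists_uniform_bounds T.width_mem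
  obtain ⟨κ', l', hκ', hκ1', -, hl', hκl'⟩ := exists_uniform_bounds S.d_mem
  obtain ⟨z, hz⟩ := hF.1
  obtain ⟨i₀, hk⟩ := T.col_surjective k
  have hd0 : ∀ i, 0 < S.d i := fun i => (S.d_mem i).1
  have hw0 : ∀ k, 0 < T.width k := fun k => (T.width_mem k).1
  set N := ⌈1 / (κ ^ 2 * κ')⌉₊ with hN
  refine ⟨(2 * N + 4) ^ 2, fun ρ hρ hρ1 ε hε => ?_⟩
  obtain ⟨V, hV, hVs⟩ := exists_cut_line hκ hκ1 hl hρ hρ1.le hκl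
  obtain ⟨U, hU, hUs⟩ := exists_cut_line (K := {i // T.col i = k})
    (c := fun i => S.d i) hκ' hκ1' hl' hρ hρ1.le (fun i => hκl' i)
  have hVcard := hV.le_card hw0 hs0 hs hρ fun w hw => (hVs w hw).2
  have hUcard := hU.le_card (fun i => hd0 i) ht0 ht hρ fun w hw => (hUs w hw).2
  -- the length of the longest word of `U`
  set L := U.sup List.length with hL
  have hdj := S.d_mem j
  have hcj := S.c_mem j
  -- `n` is so large that `m`, the number of columns needed below, exceeds `L`
  obtain ⟨n, hn1, hn2⟩ := (((tendsto_pow_atTop_nhds_zero_of_lt_one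
    (div_pos hdj.1 hcj.1).le ((div_lt_one hcj.1).2 hj)).eventually_lt_const
      (pow_pos (hw0 k) L)).and
    ((tendsto_pow_atTop_nhds_zero_of_lt_one hdj.1.le hdj.2).eventually_lt_const hε)).exists
  obtain ⟨m', hm1, hm2⟩ := exists_nat_pow_near_of_lt_one
    (pow_pos (div_pos hdj.1 hcj.1) n) (pow_le_one₀ (div_pos hdj.1 hcj.1).le
      ((div_lt_one hcj.1).2 hj).le) (hw0 k) (T.width_mem k).2
  set m := m' + 1 with hm
  set R := S.d j ^ n with hR
  have hR0 : 0 < R := pow_pos hdj.1 n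
  have hLm : L < m :=
    (pow_lt_pow_iff_right_of_lt_one₀ (hw0 k) (T.width_mem k).2).1 (hm1.trans hn1)
  have hcn : 0 < S.c j ^ n := pow_pos hcj.1 n
  have hwidth : S.c j ^ n * T.width k ^ m ≤ R := by
    rw [div_pow, lt_div_iff₀ hcn] at hm1
    linarith
  have hwidth' : κ * R ≤ S.c j ^ n * T.width k ^ m := by
    rw [div_pow, div_le_iff₀ hcn] at hm2
    have h1 := mul_le_mul (hκl k).1 hm2 hR0.le (hw0 k).le
    rw [hm, pow_succ']
    linarith
  -- the horizontal and the vertical address of a point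
  set X : List K → List K := fun v => List.replicate n (T.col j) ++ (List.replicate m k ++ v)
    with hX
  set Y : List {i // T.col i = k} → List I := fun u => List.replicate n j ++ u.map Subtype.val
    with hY
  obtain ⟨g, hg⟩ := T.col_surjective.hasRightInverse
  -- letters `i₀` fill up the `m` prescribed columns before the free columns begin
  set tail : List {i // T.col i = k} × List K → List I :=
    fun w => List.replicate (m - w.1.length) i₀ ++ w.2.map g with htail
  set f : List {i // T.col i = k} × List K → EuclideanSpace ℝ (Fin 2) :=
    fun w => S.wordMap (Y w.1 ++ tail w) z with hf
  have hfF : ∀ w, f w ∈ F := fun w => hF.wordMap_mem _ hz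
  have hf1 : ∀ w, f w 1 = wordScale S.d (Y w.1) * S.wordMap (tail w) z 1
      + wordShift S.d S.b (Y w.1) := by
    intro w
    rw [hf]
    simp only
    rw [wordMap_append, wordMap_one]
  have hXY : ∀ w ∈ U ×ˢ V, (Y w.1 ++ tail w).map T.col = X w.2 := by
    rintro ⟨u, v⟩ hw
    have hu : u.length ≤ m :=
      (Finset.le_sup (f := List.length) (Finset.mem_product.1 hw).1).trans hLm.le
    have e1 : (u.map Subtype.val).map T.col = List.replicate u.length k := by
      rw [List.eq_replicate_iff]
      refine ⟨by simp, ?_⟩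
      intro b hb
      simp only [List.mem_map] at hb
      obtain ⟨_, ⟨i, -, rfl⟩, rfl⟩ := hb
      exact i.2
    have e2 : (v.map g).map T.col = v := by
      rw [List.map_map]
      have : T.col ∘ g = id := funext hg
      rw [this, List.map_id]
    simp only [hX, hY, htail, List.map_append, e1, e2, List.map_replicate, hk]
    rw [List.append_assoc, ← List.append_assoc (List.replicate u.length k),
      List.replicate_append_replicate, Nat.add_sub_cancel' hu]
  have hf0 : ∀ w ∈ U ×ˢ V, f w 0 = wordScale T.width (X w.2) * z 0
      + wordShift T.width T.left (X w.2) := by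
    intro w hw
    rw [hf]
    simp only
    rw [wordMap_zero, ← hXY w hw, T.wordScale_map_col, T.wordShift_map_col]
  have hz0 := hF.mem_Icc_zero T.mapsUnit_fst hz
  have hXs : ∀ v, wordScale T.width (X v) = S.c j ^ n * T.width k ^ m * wordScale T.width v := by
    intro v
    simp only [hX, wordScale_append, wordScale_replicate, T.width_col, mul_assoc]
  have hYs : ∀ u, wordScale S.d (Y u) = R * wordScale (fun i => S.d (Subtype.val i)) u := by
    intro u
    simp only [hY, wordScale_append, wordScale_replicate, wordScale_map, hR]
  have hne : (U ×ˢ V).Nonempty := by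
    refine Finset.Nonempty.product ?_ ?_
    · exact Finset.card_pos.1 (by exact_mod_cast (Real.rpow_pos_of_pos hρ _).trans_le hUcard)
    · exact Finset.card_pos.1 (by exact_mod_cast (Real.rpow_pos_of_pos hρ _).trans_le hVcard)
  obtain ⟨w₀, hw₀⟩ := hne
  refine ⟨R, hR0, hn2.le, f w₀, hfF w₀, (U ×ˢ V).card, ?_, ?_⟩
  · rw [Finset.card_product, neg_add, Real.rpow_add hρ, Nat.cast_mul, mul_comm]
    exact mul_le_mul hUcard hVcard (Real.rpow_pos_of_pos hρ _).le (Nat.cast_nonneg _)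
  refine card_le_mul_openCoverNumber (by positivity) _ f ?_ _ ?_
  · intro w hw
    refine ⟨?_, hfF w⟩
    rw [Metric.mem_closedBall]
    refine (dist_le_abs_add_abs _ _).trans ?_
    have h0 : |f w 0 - f w₀ 0| ≤ R := by
      have key : ∀ v, ∃ y ∈ Icc (0 : ℝ) 1,
          wordScale T.width (X v) * z 0 + wordShift T.width T.left (X v)
          = S.c j ^ n * T.width k ^ m * y + wordShift T.width T.left (X []) := by
        intro v
        refine ⟨wordScale T.width v * z 0 + wordShift T.width T.left v, ?_, ?_⟩
        · obtain ⟨h1, h2⟩ := T.mapsUnit_width.word v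
          have h3 := affine_mem_Icc (a := wordShift T.width T.left v) (wordScale_pos hw0 v).le hz0
          exact ⟨h1.trans h3.1, h3.2.trans h2⟩
        · rw [hXs]
          simp only [hX, wordShift_append, wordScale_replicate, T.width_col, wordShift]
          ring
      obtain ⟨y, hy0, hy⟩ := key w.2
      obtain ⟨y', hy0', hy'⟩ := key w₀.2
      rw [hf0 w hw, hf0 w₀ hw₀, hy, hy']
      exact abs_affine_sub_le (mul_pos hcn (pow_pos (hw0 k) m)).le hwidth hy0 hy0'
    have h1 : |f w 1 - f w₀ 1| ≤ R := by
      have key : ∀ w : List {i // T.col i = k} × List K, ∃ y ∈ Icc (0 : ℝ) 1,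
          f w 1 = R * y + wordShift S.d S.b (List.replicate n j) := by
        intro w
        refine ⟨S.wordMap (w.1.map Subtype.val ++ tail w) z 1,
          hF.mem_Icc_one T.mapsUnit_snd (hF.wordMap_mem _ hz), ?_⟩
        simp only [hf, hY, List.append_assoc]
        rw [wordMap_append, wordMap_one, wordScale_replicate]
      obtain ⟨y, hy0, hy⟩ := key w
      obtain ⟨y', hy0', hy'⟩ := key w₀
      rw [hy, hy']
      exact abs_affine_sub_le hR0.le le_rfl hy0 hy0'
    linarith
  · intro v₀ hv₀ W hW hclose
    refine card_le_of_apart (e := κ ^ 2 * κ' * (ρ * R)) (R := ρ * R) (x := f v₀ 0) (y := f v₀ 1) W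
      (a := fun w => wordShift T.width T.left (X w.2)) (c := fun w => wordScale T.width (X w.2))
      (b := fun w => wordShift S.d S.b (Y w.1)) (d := fun w => wordScale S.d (Y w.1))
      (p := fun w => f w 0) (q := fun w => f w 1) (by positivity) ?_ ?_ ?_ ?_ ?_ ?_
    · rw [← mul_assoc]
      refine le_mul_of_one_le_left (by positivity) ?_
      rw [← div_le_iff₀ (by positivity)]
      exact Nat.le_ceil _
    · intro w hw
      have h1 := (hVs w.2 (Finset.mem_product.1 (hW hw)).2).1
      simp only [hXs]
      have h2 := mul_le_mul hwidth' h1 (by positivity)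
        (mul_pos hcn (pow_pos (hw0 k) m)).le
      refine le_trans ?_ h2
      have h3 : 0 ≤ κ ^ 2 * (ρ * R) := by positivity
      nlinarith
    · intro w hw
      have h1 := (hUs w.1 (Finset.mem_product.1 (hW hw)).1).1
      simp only [hYs]
      have h2 := mul_le_mul_of_nonneg_left h1 hR0.le
      refine le_trans ?_ h2
      have h3 : 0 ≤ κ' * (ρ * R) := by positivity
      have h4 : κ ^ 2 ≤ 1 := pow_le_one₀ hκ.le hκ1
      nlinarith
    · intro v hv w hw hvw
      obtain ⟨hv1, hv2⟩ := Finset.mem_product.1 (hW hv)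
      obtain ⟨hw1, hw2⟩ := Finset.mem_product.1 (hW hw)
      by_cases h : v.2 = w.2
      · right
        have hne : v.1 ≠ w.1 := fun h' => hvw (Prod.ext h' h)
        have := hU.apart_line (K := {i // T.col i = k}) (c := fun i => S.d i) (a := fun i => S.b i)
          (fun i => T.mapsUnit_snd i)
          (fun i l hil => T.apart_of_col_eq i l (fun h => hil (Subtype.ext h))
            (i.2.trans l.2.symm)) hv1 hw1 hne
        rw [← wordShift_map S.d S.b Subtype.val, ← wordShift_map S.d S.b Subtype.val,
          ← wordScale_map S.d Subtype.val, ← wordScale_map S.d Subtype.val] at this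
        exact this.append hd0
      · left
        exact ((hV.apart_line T.mapsUnit_width T.apart_columns hv2 hw2 h).append hw0).append hw0
    · intro w hw
      have hp := affine_mem_Icc (a := wordShift T.width T.left (X w.2))
        (wordScale_pos hw0 (X w.2)).le hz0
      rw [← hf0 w (hW hw)] at hp
      exact ⟨hp.1, hp.2, (abs_sub_apply_le_dist _ _ 0).trans (hclose w hw)⟩
    · intro w hw
      have hp := affine_mem_Icc (a := wordShift S.d S.b (Y w.1)) (wordScale_pos hd0 (Y w.1)).le
        (hF.mem_Icc_one T.mapsUnit_snd (hF.wordMap_mem (tail w) hz))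
      rw [← hf1 w] at hp
      exact ⟨hp.1, hp.2, (abs_sub_apply_le_dist _ _ 1).trans (hclose w hw)⟩

theorem le_assouadDim [Fintype I] [Fintype K] [DecidableEq K] (T : S.Columns K)
    (hF : S.IsAttractor F) {s : ℝ} (hs0 : 0 ≤ s) (hs : ∑ k, T.width k ^ s = 1)
    {j : I} (hj : S.d j < S.c j) (k : K) {t : ℝ} (ht0 : 0 ≤ t)
    (ht : ∑ i : {i // T.col i = k}, S.d i ^ t = 1) :
    ((s + t : ℝ) : EReal) ≤ assouadDim F := by
  obtain ⟨M, hM⟩ := T.exists_many_points hF hs0 hs hj k ht0 ht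
  refine le_sInf ?_
  rintro _ ⟨α, ⟨C, hC, ε, hε, h⟩, rfl⟩
  refine EReal.coe_le_coe_iff.2 (not_lt.1 fun hlt => ?_)
  have hγ : 0 < s + t - α := sub_pos.2 hlt
  have hD : 0 < M * C * 2 ^ α + 2 := by positivity
  -- at this `ρ` the lower bound `ρ ^ (-(s + t))` exceeds `M * C * (2 / ρ) ^ α`
  set ρ := (M * C * 2 ^ α + 2) ^ (-(1 / (s + t - α))) with hρdef
  have hρ : 0 < ρ := Real.rpow_pos_of_pos hD _
  have hρ1 : ρ < 1 := by
    apply Real.rpow_lt_one_of_one_lt_of_neg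
    · have : 0 ≤ M * C * (2 : ℝ) ^ α := by positivity
      linarith
    · rw [neg_lt_zero]; positivity
  have hρD : ρ ^ (-(s + t - α)) = M * C * 2 ^ α + 2 := by
    rw [hρdef, ← Real.rpow_mul hD.le, neg_mul_neg, one_div_mul_cancel hγ.ne', Real.rpow_one]
  obtain ⟨R, hR, hRε, x, hx, n, hn, hnM⟩ := hM ρ hρ hρ1 (ε / 2) (by positivity)
  have h1 := h (ρ * R) (2 * R) (by positivity) (by nlinarith) (by linarith) x hx
  have hratio : 2 * R / (ρ * R) = 2 / ρ := by field_simp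
  rw [hratio] at h1
  have htop : openCoverNumber (ρ * R) (Metric.closedBall x (2 * R) ∩ F) ≠ ⊤ := by
    intro htop
    rw [htop] at h1
    simp at h1
  lift openCoverNumber (ρ * R) (Metric.closedBall x (2 * R) ∩ F) to ℕ using htop with q
  have h2 : (q : ℝ) ≤ C * (2 / ρ) ^ α := by
    have hpos : 0 ≤ C * (2 / ρ) ^ α := by positivity
    rw [ENat.toENNReal_coe, ← ENNReal.ofReal_natCast, ENNReal.ofReal_le_ofReal_iff hpos] at h1
    exact h1
  have h3 : (n : ℝ) ≤ M * q := by exact_mod_cast hnM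
  have h4 : ρ ^ (-(s + t)) ≤ M * C * 2 ^ α * ρ ^ (-α) := by
    rw [Real.div_rpow two_pos.le hρ.le] at h2
    have := mul_le_mul_of_nonneg_left h2 (Nat.cast_nonneg M : (0 : ℝ) ≤ M)
    rw [Real.rpow_neg hρ.le α]
    calc ρ ^ (-(s + t)) ≤ M * (C * (2 ^ α / ρ ^ α)) := hn.trans (h3.trans this)
      _ = _ := by ring
  have h5 : ρ ^ (-(s + t)) = ρ ^ (-(s + t - α)) * ρ ^ (-α) := by
    rw [← Real.rpow_add hρ]; congr 1; ring
  rw [h5, hρD] at h4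
  have := le_of_mul_le_mul_right h4 (Real.rpow_pos_of_pos hρ _)
  linarith

end Columns

end DiagonalIFS

/-! ### Covers by rectangles -/

/-- The plane set `A` is covered by at most `n` closed rectangles of width `w` and height `h`. -/
def RectCover (w h : ℝ) (A : Set (EuclideanSpace ℝ (Fin 2))) (n : ℝ) : Prop :=
  ∃ P : Finset (ℝ × ℝ), (P.card : ℝ) ≤ n ∧
    ∀ p ∈ A, ∃ z ∈ P, p 0 ∈ Icc z.1 (z.1 + w) ∧ p 1 ∈ Icc z.2 (z.2 + h)

namespace RectCover

variable {w h w' h' n n' : ℝ} {A A' : Set (EuclideanSpace ℝ (Fin 2))}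

theorem mono (H : RectCover w h A n) (hA : A' ⊆ A) (hw : w ≤ w') (hh : h ≤ h') (hn : n ≤ n') :
    RectCover w' h' A' n' := by
  obtain ⟨P, hP, hPA⟩ := H
  refine ⟨P, hP.trans hn, fun p hp => ?_⟩
  obtain ⟨z, hz, h1, h2⟩ := hPA p (hA hp)
  exact ⟨z, hz, ⟨h1.1, h1.2.trans (by linarith)⟩, ⟨h2.1, h2.2.trans (by linarith)⟩⟩

theorem biUnion {ι : Type*} (J : Finset ι) {A : ι → Set (EuclideanSpace ℝ (Fin 2))} {n : ι → ℝ}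
    (H : ∀ j ∈ J, RectCover w h (A j) (n j)) :
    RectCover w h (⋃ j ∈ J, A j) (∑ j ∈ J, n j) := by
  classical
  choose! P hP hPA using H
  refine ⟨J.biUnion P, ?_, ?_⟩
  · refine (Nat.cast_le.2 Finset.card_biUnion_le).trans ?_
    rw [Nat.cast_sum]
    exact Finset.sum_le_sum hP
  · intro p hp
    obtain ⟨j, hj, hpj⟩ := mem_iUnion₂.1 hp
    obtain ⟨z, hz, h⟩ := hPA j hj p hpj
    exact ⟨z, Finset.mem_biUnion.2 ⟨j, hj, hz⟩, h⟩

theorem of_swapPlane (H : RectCover h w (swapPlane '' A) n) : RectCover w h A n := by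
  classical
  obtain ⟨P, hP, hPA⟩ := H
  refine ⟨P.image Prod.swap, (Nat.cast_le.2 Finset.card_image_le).trans hP, fun p hp => ?_⟩
  obtain ⟨z, hz, h1, h2⟩ := hPA _ (mem_image_of_mem _ hp)
  rw [swapPlane_zero] at h1
  rw [swapPlane_one] at h2
  exact ⟨z.swap, Finset.mem_image_of_mem _ hz, h2, h1⟩

theorem wordMap {I : Type*} (S : DiagonalIFS I) (v : List I)
    (H : RectCover (w / wordScale S.c v) (h / wordScale S.d v) A n) :
    RectCover w h (S.wordMap v '' A) n := by
  classical
  obtain ⟨P, hP, hPA⟩ := H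
  have hc := wordScale_pos (fun i => (S.c_mem i).1) v
  have hd := wordScale_pos (fun i => (S.d_mem i).1) v
  refine ⟨P.image fun z => (wordScale S.c v * z.1 + wordShift S.c S.a v,
    wordScale S.d v * z.2 + wordShift S.d S.b v),
    (Nat.cast_le.2 Finset.card_image_le).trans hP, ?_⟩
  rintro _ ⟨p, hp, rfl⟩
  obtain ⟨z, hz, h1, h2⟩ := hPA p hp
  refine ⟨_, Finset.mem_image_of_mem _ hz, ?_, ?_⟩
  · rw [DiagonalIFS.wordMap_zero]
    have e : wordScale S.c v * (w / wordScale S.c v) = w := mul_div_cancel₀ _ hc.ne'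
    have := mul_le_mul_of_nonneg_left h1.1 hc.le
    have := mul_le_mul_of_nonneg_left h1.2 hc.le
    constructor <;> simp only <;> linarith
  · rw [DiagonalIFS.wordMap_one]
    have e : wordScale S.d v * (h / wordScale S.d v) = h := mul_div_cancel₀ _ hd.ne'
    have := mul_le_mul_of_nonneg_left h2.1 hd.le
    have := mul_le_mul_of_nonneg_left h2.2 hd.le
    constructor <;> simp only <;> linarith

theorem map {I : Type*} (S : DiagonalIFS I) (i : I)
    (H : RectCover (w / S.c i) (h / S.d i) A n) : RectCover w h (S.map i '' A) n :=
  wordMap S [i] (by simpa [wordScale] using H)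

theorem openCoverNumber_le {r : ℝ} (hr : 0 < r) (H : RectCover (r / 4) (r / 4) A n) :
    ((openCoverNumber r A : ℕ∞) : ENNReal) ≤ ENNReal.ofReal n := by
  obtain ⟨P, hP, hPA⟩ := H
  have h1 := _root_.openCoverNumber_le hr (A := A) P
    (fun z => {p | p 0 ∈ Icc z.1 (z.1 + r / 4) ∧ p 1 ∈ Icc z.2 (z.2 + r / 4)}) ?_ ?_
  · have h2 : ((openCoverNumber r A : ℕ∞) : ENNReal) ≤ ((P.card : ℕ∞) : ENNReal) := by
      exact_mod_cast h1
    refine h2.trans (le_trans ?_ (ENNReal.ofReal_le_ofReal hP))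
    simp
  · intro p hp
    obtain ⟨z, hz, h⟩ := hPA p hp
    exact mem_iUnion₂.2 ⟨z, hz, h⟩
  · rintro z - p ⟨⟨h1, h2⟩, h3, h4⟩ q ⟨⟨h5, h6⟩, h7, h8⟩
    refine (dist_le_abs_add_abs p q).trans ?_
    have e1 : |p 0 - q 0| ≤ r / 4 := abs_le.2 ⟨by linarith, by linarith⟩
    have e2 : |p 1 - q 1| ≤ r / 4 := abs_le.2 ⟨by linarith, by linarith⟩
    linarith

end RectCover

/-! ### The upper bound for the Assouad dimension -/

namespace DiagonalIFS

variable {I K : Type*} {S : DiagonalIFS I} {F : Set (EuclideanSpace ℝ (Fin 2))}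

theorem swap_wordMap (w : List I) (p : EuclideanSpace ℝ (Fin 2)) :
    S.swap.wordMap w (swapPlane p) = swapPlane (S.wordMap w p) := by
  induction w with
  | nil => rfl
  | cons i w ih =>
    simp only [wordMap, List.foldr_cons] at ih ⊢
    rw [ih, swap_map]

namespace Columns

/-- The part of `F` over the column, of level the length of `ω`, coded by the word `ω`: the union
of the images of `F` under the compositions of maps from the columns in the list `ω`. -/
def strip (T : S.Columns K) (F : Set (EuclideanSpace ℝ (Fin 2))) :
    List K → Set (EuclideanSpace ℝ (Fin 2))
  | [] => F
  | k :: ω => ⋃ i ∈ {i | T.col i = k}, S.map i '' strip T F ω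

theorem exists_of_mem_strip (T : S.Columns K) {ω : List K} {p : EuclideanSpace ℝ (Fin 2)}
    (hp : p ∈ T.strip F ω) :
    ∃ y ∈ axisProj 0 F, p 0 = wordScale T.width ω * y + wordShift T.width T.left ω := by
  induction ω generalizing p with
  | nil => exact ⟨p 0, ⟨p, hp, rfl⟩, by simp [wordScale, wordShift]⟩
  | cons k ω ih =>
    obtain ⟨i, rfl, q, hq, rfl⟩ := mem_iUnion₂.1 hp
    obtain ⟨y, hy, h⟩ := ih hq
    refine ⟨y, hy, ?_⟩
    rw [map_zero, h, wordScale, wordShift, T.width_col, T.left_col]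
    ring

theorem strip_subset (T : S.Columns K) (hF : S.IsAttractor F) (ω : List K) : T.strip F ω ⊆ F := by
  induction ω with
  | nil => exact Subset.rfl
  | cons k ω ih =>
    intro p hp
    obtain ⟨i, rfl, q, hq, rfl⟩ := mem_iUnion₂.1 hp
    exact hF.map_mem i (ih hq)

theorem exists_mem_strip [Fintype K] (T : S.Columns K) (hF : S.IsAttractor F)
    {W : Finset (List K)} (hW : IsCut W) {p : EuclideanSpace ℝ (Fin 2)} (hp : p ∈ F) :
    ∃ ω ∈ W, p ∈ T.strip F ω := by
  induction hW generalizing p with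
  | nil => exact ⟨[], by simp, hp⟩
  | node V _ ih =>
    obtain ⟨i, q, hq, rfl⟩ := hF.exists_map hp
    obtain ⟨ω, hω, h⟩ := ih (T.col i) hq
    refine ⟨T.col i :: ω, ?_, mem_iUnion₂.2 ⟨i, rfl, q, h, rfl⟩⟩
    simp only [Finset.mem_biUnion, Finset.mem_univ, true_and, Finset.mem_map]
    exact ⟨T.col i, ω, hω, rfl⟩

/-- Rectangles of height at least one cover a strip as soon as their bases cover its projection. -/
theorem exists_rectCover_strip_of_one_le [Fintype K] (T : S.Columns K) (hF : S.IsAttractor F)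
    {s : ℝ} (hs0 : 0 ≤ s) (hs : ∑ k, T.width k ^ s = 1) (B : ℝ) :
    ∃ C > 0, ∀ (ω : List K) (w h : ℝ), 0 < w → w ≤ B → 1 ≤ h →
      RectCover (w * wordScale T.width ω) h (T.strip F ω) (C * w ^ (-s)) := by
  classical
  obtain ⟨C, hC, hcov⟩ := exists_line_cover T.width_mem (T.axisProj_eq hF) (T.axisProj_subset hF)
    hs0 hs B
  refine ⟨C, hC, fun ω w h hw hwB hh => ?_⟩
  obtain ⟨P, hP, hPE⟩ := hcov w hw hwB
  refine ⟨P.image fun x => (wordScale T.width ω * x + wordShift T.width T.left ω, 0),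
    (Nat.cast_le.2 Finset.card_image_le).trans hP, fun p hp => ?_⟩
  obtain ⟨y, hy, hpy⟩ := T.exists_of_mem_strip hp
  obtain ⟨x, hx, hx1, hx2⟩ := mem_iUnion₂.1 (hPE hy)
  have hp1 := hF.mem_Icc_one T.mapsUnit_snd (T.strip_subset hF ω hp)
  refine ⟨_, Finset.mem_image_of_mem _ hx, ?_, ⟨hp1.1, hp1.2.trans (by linarith)⟩⟩
  rw [hpy]
  have h0 := (wordScale_pos (fun k => (T.width_mem k).1) ω).le
  have := mul_le_mul_of_nonneg_left hx1 h0
  have := mul_le_mul_of_nonneg_left hx2 h0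
  constructor <;> simp only <;> linarith

end Columns

/-- A bound `C * G w h` for the number of rectangles of width `w` and height `h` needed to cover the
attractor follows from the case where a side is about one, if the bounds are additive under the
subdivision `F = ⋃ i, S_i(F)`. The relation `D` restricts the shape of the rectangles. -/
theorem IsAttractor.rectCover [Fintype I] (hF : S.IsAttractor F) {G : ℝ → ℝ → ℝ}
    {D : ℝ → ℝ → Prop} {B C : ℝ} (hC : 0 ≤ C) (hB : ∀ i, 1 ≤ B * S.c i ∧ 1 ≤ B * S.d i)
    (hD : ∀ i w h, 0 < h → D w h → D (w / S.c i) (h / S.d i))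
    (hG : ∀ w h, 0 < w → 0 < h → ∑ i, G (w / S.c i) (h / S.d i) ≤ G w h)
    (hbase : ∀ w h, 0 < w → w ≤ B → 0 < h → h ≤ B → D w h → 1 ≤ w ∨ 1 ≤ h →
      RectCover w h F (C * G w h))
    {w h : ℝ} (hw : 0 < w) (hwB : w ≤ B) (hh : 0 < h) (hhB : h ≤ B) (hwh : D w h) :
    RectCover w h F (C * G w h) := by
  obtain ⟨κ, l, hκ, -, hl0, hl, hκl⟩ := exists_uniform_bounds S.c_mem
  obtain ⟨n, hn⟩ := exists_pow_lt_of_lt_one hw hl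
  induction n generalizing w h with
  | zero => exact hbase w h hw hwB hh hhB hwh (Or.inl (by simpa using hn.le))
  | succ n ih =>
    by_cases h1 : 1 ≤ w ∨ 1 ≤ h
    · exact hbase w h hw hwB hh hhB hwh h1
    push Not at h1
    have key : ∀ i ∈ (Finset.univ : Finset I),
        RectCover w h (S.map i '' F) (C * G (w / S.c i) (h / S.d i)) := by
      intro i _
      have hc := (S.c_mem i).1
      have hd := (S.d_mem i).1
      refine RectCover.map S i (ih (div_pos hw hc) ?_ (div_pos hh hd) ?_ (hD i w h hh hwh) ?_)
      · rw [div_le_iff₀ hc]; linarith [(hB i).1]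
      · rw [div_le_iff₀ hd]; linarith [(hB i).2]
      · rw [lt_div_iff₀ hc]
        refine lt_of_le_of_lt ?_ hn
        rw [pow_succ]
        exact mul_le_mul_of_nonneg_left (hκl i).2 (pow_nonneg hl0 n)
    refine (RectCover.biUnion _ key).mono ?_ le_rfl le_rfl ?_
    · intro p hp
      obtain ⟨i, q, hq, rfl⟩ := hF.exists_map hp
      exact mem_iUnion₂.2 ⟨i, Finset.mem_univ i, q, hq, rfl⟩
    · rw [← Finset.mul_sum]
      exact mul_le_mul_of_nonneg_left (hG w h hw hh) hC

namespace Columns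

/-- The analogue for strips: a bound for the whole attractor and for rectangles of height about one
is inherited by the strips, if it is additive under the subdivision of a single column. -/
theorem rectCover_strip [Fintype I] [DecidableEq K] (T : S.Columns K) {G : ℝ → ℝ → ℝ}
    {D : ℝ → ℝ → Prop} {B C : ℝ} (hC : 0 ≤ C) (hB : ∀ i, 1 ≤ B * S.d i)
    (hD : ∀ i w h, 0 < h → D w h → D w (h / S.d i))
    (hG : ∀ k w h, 0 < w → 0 < h → ∑ i with T.col i = k, G w (h / S.d i) ≤ G w h)
    (hbase : ∀ ω w h, 0 < w → w ≤ B → 1 ≤ h → h ≤ B → D w h →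
      RectCover (w * wordScale T.width ω) h (T.strip F ω) (C * G w h))
    (hF : ∀ w h, 0 < w → w ≤ B → 0 < h → h ≤ B → D w h → RectCover w h F (C * G w h))
    (ω : List K) {w h : ℝ} (hw : 0 < w) (hwB : w ≤ B) (hh : 0 < h) (hhB : h ≤ B) (hwh : D w h) :
    RectCover (w * wordScale T.width ω) h (T.strip F ω) (C * G w h) := by
  induction ω generalizing h with
  | nil => simpa [wordScale, strip] using hF w h hw hwB hh hhB hwh
  | cons k ω ih =>
    rcases le_or_gt 1 h with h1 | h1
    · exact hbase _ w h hw hwB h1 hhB hwh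
    have key : ∀ i ∈ (Finset.univ.filter fun i => T.col i = k),
        RectCover (w * wordScale T.width (k :: ω)) h (S.map i '' T.strip F ω)
          (C * G w (h / S.d i)) := by
      intro i hi
      have hik : T.col i = k := (Finset.mem_filter.1 hi).2
      have hc := (S.c_mem i).1
      have hd := (S.d_mem i).1
      apply RectCover.map
      have e : w * wordScale T.width (k :: ω) / S.c i = w * wordScale T.width ω := by
        rw [wordScale, ← hik, T.width_col]
        field_simp
      rw [e]
      refine ih (div_pos hh hd) ?_ (hD i w h hh hwh)
      rw [div_le_iff₀ hd]; linarith [hB i]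
    refine (RectCover.biUnion _ key).mono ?_ le_rfl le_rfl ?_
    · intro p hp
      obtain ⟨i, hi, hp⟩ := mem_iUnion₂.1 hp
      exact mem_iUnion₂.2 ⟨i, Finset.mem_filter.2 ⟨Finset.mem_univ i, hi⟩, hp⟩
    · rw [← Finset.mul_sum]
      exact mul_le_mul_of_nonneg_left (hG k w h hw hh) hC

/-- A strip of width `c`, rescaled to have width one, is covered by `O(ρ ^ (-α))` squares of
side `ρ`. -/
def StripBound (T : S.Columns K) (F : Set (EuclideanSpace ℝ (Fin 2))) (α : ℝ) : Prop :=
  ∃ C > 0, ∀ (ω : List K) (ρ : ℝ), 0 < ρ → ρ ≤ 1 →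
    RectCover (ρ * wordScale T.width ω) ρ (T.strip F ω) (C * ρ ^ (-α))

theorem sum_mul_le_one [Fintype I] [Fintype K] [DecidableEq K] (T : S.Columns K) {s t : ℝ}
    (hs : ∑ k, T.width k ^ s = 1) (ht : ∀ k, ∑ i with T.col i = k, S.d i ^ t ≤ 1) :
    ∑ i, S.c i ^ s * S.d i ^ t ≤ 1 := by
  rw [← hs, ← Finset.sum_fiberwise Finset.univ T.col]
  refine Finset.sum_le_sum fun k _ => ?_
  calc ∑ i with T.col i = k, S.c i ^ s * S.d i ^ t
      = ∑ i with T.col i = k, T.width k ^ s * S.d i ^ t := by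
        refine Finset.sum_congr rfl fun i hi => ?_
        rw [← (Finset.mem_filter.1 hi).2, T.width_col]
    _ = T.width k ^ s * ∑ i with T.col i = k, S.d i ^ t := by rw [Finset.mul_sum]
    _ ≤ T.width k ^ s :=
        mul_le_of_le_one_right (Real.rpow_nonneg (T.width_mem k).1.le _) (ht k)

end Columns

theorem div_rpow_neg {x c s : ℝ} (hx : 0 < x) (hc : 0 < c) :
    (x / c) ^ (-s) = c ^ s * x ^ (-s) := by
  rw [Real.div_rpow hx.le hc.le, Real.rpow_neg hc.le, div_inv_eq_mul, mul_comm]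

/-- Sides less than one are still at most `B` after a step of the subdivision. -/
theorem exists_side_bound [Finite I] (S : DiagonalIFS I) :
    ∃ B, 1 ≤ B ∧ ∀ i, 1 ≤ B * S.c i ∧ 1 ≤ B * S.d i := by
  obtain ⟨κ, l, hκ, hκ1, -, -, hκl⟩ := exists_uniform_bounds S.c_mem
  obtain ⟨κ', l', hκ', hκ1', -, -, hκl'⟩ := exists_uniform_bounds S.d_mem
  have h1 := one_le_one_div hκ hκ1
  have h2 := one_le_one_div hκ' hκ1'
  refine ⟨max (1 / κ) (1 / κ'), le_max_of_le_left h1, fun i => ⟨?_, ?_⟩⟩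
  · refine (one_div_mul_cancel hκ.ne').symm.trans_le ?_
    exact mul_le_mul (le_max_left _ _) (hκl i).1 hκ.le (by positivity)
  · refine (one_div_mul_cancel hκ'.ne').symm.trans_le ?_
    exact mul_le_mul (le_max_right _ _) (hκl' i).1 hκ'.le (by positivity)

namespace Columns

/-- If all images are at least as wide as high, it suffices to consider rectangles which are at
least as high as wide. -/
theorem stripBound_of_horizontal [Fintype I] [Fintype K] [DecidableEq K] (T : S.Columns K)
    (hF : S.IsAttractor F) (hS : S.IsHorizontal) {s t : ℝ} (hs0 : 0 ≤ s)
    (hs : ∑ k, T.width k ^ s = 1) (ht0 : 0 ≤ t)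
    (ht : ∀ k, ∑ i with T.col i = k, S.d i ^ t ≤ 1) : T.StripBound F (s + t) := by
  obtain ⟨B, hB1, hB⟩ := S.exists_side_bound
  obtain ⟨C, hC, hone⟩ := T.exists_rectCover_strip_of_one_le hF hs0 hs B
  have hB0 : 0 < B := one_pos.trans_le hB1
  -- the factor `B ^ t` below makes up for `h ^ (-t)` being small when `h` exceeds one
  set G : ℝ → ℝ → ℝ := fun w h => w ^ (-s) * h ^ (-t) with hG
  have hbase : ∀ ω w h, 0 < w → w ≤ B → 1 ≤ h → h ≤ B → w ≤ h →
      RectCover (w * wordScale T.width ω) h (T.strip F ω) (C * B ^ t * G w h) := by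
    intro ω w h hw hwB hh hhB _
    have hh0 : 0 < h := one_pos.trans_le hh
    refine (hone ω w h hw hwB hh).mono Subset.rfl le_rfl le_rfl ?_
    have h1 : 1 ≤ B ^ t * h ^ (-t) := by
      rw [← div_rpow_neg hh0 hB0]
      exact Real.one_le_rpow_of_pos_of_le_one_of_nonpos (by positivity) ((div_le_one hB0).2 hhB)
        (by linarith)
    have h2 : 0 ≤ C * w ^ (-s) := by positivity
    calc C * w ^ (-s) ≤ C * w ^ (-s) * (B ^ t * h ^ (-t)) := le_mul_of_one_le_right h2 h1
      _ = _ := by rw [hG]; ring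
  have hwhole : ∀ w h, 0 < w → w ≤ B → 0 < h → h ≤ B → w ≤ h →
      RectCover w h F (C * B ^ t * G w h) := by
    intro w h hw hwB hh hhB hwh
    refine hF.rectCover (by positivity) hB ?_ ?_ ?_ hw hwB hh hhB hwh
    · intro i w h hh hwh
      exact div_le_div₀ hh.le hwh (S.d_mem i).1 (hS i)
    · intro w h hw hh
      simp only [hG]
      calc ∑ i, (w / S.c i) ^ (-s) * (h / S.d i) ^ (-t)
          = (∑ i, S.c i ^ s * S.d i ^ t) * (w ^ (-s) * h ^ (-t)) := by
            rw [Finset.sum_mul]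
            refine Finset.sum_congr rfl fun i _ => ?_
            rw [div_rpow_neg hw (S.c_mem i).1, div_rpow_neg hh (S.d_mem i).1]
            ring
        _ ≤ _ := mul_le_of_le_one_left (by positivity) (T.sum_mul_le_one hs ht)
    · intro w h hw hwB hh hhB hwh h1
      have := hbase [] w h hw hwB (h1.elim (fun h => h.trans hwh) id) hhB hwh
      simpa [wordScale, strip] using this
  refine ⟨C * B ^ t, by positivity, fun ω ρ hρ hρ1 => ?_⟩
  have := T.rectCover_strip (F := F) (G := G) (D := fun w h => w ≤ h) (B := B) (C := C * B ^ t)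
    (by positivity) (fun i => (hB i).2) ?_ ?_ hbase hwhole ω hρ (hρ1.trans hB1) hρ (hρ1.trans hB1)
    le_rfl
  · refine this.mono Subset.rfl le_rfl le_rfl (le_of_eq ?_)
    rw [hG, neg_add, Real.rpow_add hρ]
  · intro i w h hh hwh
    exact hwh.trans (le_div_self hh.le (S.d_mem i).1 (S.d_mem i).2.le)
  · intro k w h hw hh
    simp only [hG]
    calc ∑ i with T.col i = k, w ^ (-s) * (h / S.d i) ^ (-t)
        = (∑ i with T.col i = k, S.d i ^ t) * (w ^ (-s) * h ^ (-t)) := by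
          rw [Finset.sum_mul]
          refine Finset.sum_congr rfl fun i _ => ?_
          rw [div_rpow_neg hh (S.d_mem i).1]
          ring
      _ ≤ _ := mul_le_of_le_one_left (by positivity) (ht k)

end Columns

end DiagonalIFS

namespace DiagonalIFS

variable {I K : Type*} {S : DiagonalIFS I} {F : Set (EuclideanSpace ℝ (Fin 2))}

namespace Columns

/-- If the system is arranged both in columns and in rows, forming a grid, then all shapes of
rectangles are allowed. The bound is the sum of those for the two arrangements; the second of them
is additive in columns, too, as the members of a column lie in distinct rows. -/
theorem stripBound_of_grid [Fintype I] {K' : Type*} [Fintype K] [DecidableEq K] [Fintype K']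
    [DecidableEq K'] (T : S.Columns K) (T' : S.swap.Columns K')
    (hTT : ∀ i j, T.col i = T.col j → T'.col i = T'.col j → i = j)
    (hF : S.IsAttractor F) {s t s' t' α : ℝ} (hs0 : 0 ≤ s)
    (hs : ∑ k, T.width k ^ s = 1) (ht0 : 0 ≤ t)
    (ht : ∀ k, ∑ i with T.col i = k, S.d i ^ t ≤ 1) (hs0' : 0 ≤ s')
    (hs' : ∑ k, T'.width k ^ s' = 1) (ht0' : 0 ≤ t')
    (ht' : ∀ k, ∑ i with T'.col i = k, S.c i ^ t' ≤ 1) (hα : s + t ≤ α) (hα' : s' + t' ≤ α) :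
    T.StripBound F α := by
  obtain ⟨B, hB1, hB⟩ := S.exists_side_bound
  obtain ⟨C, hC, hone⟩ := T.exists_rectCover_strip_of_one_le hF hs0 hs B
  obtain ⟨C', hC', hone'⟩ := T'.exists_rectCover_strip_of_one_le hF.swap hs0' hs' B
  have hB0 : 0 < B := one_pos.trans_le hB1
  set G : ℝ → ℝ → ℝ := fun w h => w ^ (-s) * h ^ (-t) + h ^ (-s') * w ^ (-t') with hG
  set A := C * B ^ t + C' * B ^ t' with hA
  have hA0 : 0 < A := by positivity
  have hpow : ∀ {x y : ℝ}, 0 < x → x ≤ B → 0 ≤ y → 1 ≤ B ^ y * x ^ (-y) := by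
    intro x y hx hxB hy
    rw [← div_rpow_neg hx hB0]
    exact Real.one_le_rpow_of_pos_of_le_one_of_nonpos (by positivity) ((div_le_one hB0).2 hxB)
      (by linarith)
  have hbase : ∀ ω w h, 0 < w → w ≤ B → 1 ≤ h → h ≤ B → True →
      RectCover (w * wordScale T.width ω) h (T.strip F ω) (A * G w h) := by
    intro ω w h hw hwB hh hhB _
    have hh0 : 0 < h := one_pos.trans_le hh
    refine (hone ω w h hw hwB hh).mono Subset.rfl le_rfl le_rfl ?_
    have h2 : 0 ≤ C * w ^ (-s) := by positivity
    calc C * w ^ (-s) ≤ C * w ^ (-s) * (B ^ t * h ^ (-t)) :=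
          le_mul_of_one_le_right h2 (hpow hh0 hhB ht0)
      _ = C * B ^ t * (w ^ (-s) * h ^ (-t)) := by ring
      _ ≤ A * G w h := mul_le_mul (le_add_of_nonneg_right (by positivity))
          (le_add_of_nonneg_right (by positivity)) (by positivity) hA0.le
  have hbase' : ∀ w h, 0 < w → 1 ≤ w → w ≤ B → 0 < h → h ≤ B → RectCover w h F (A * G w h) := by
    intro w h hw hw1 hwB hh hhB
    have h0 : RectCover h w (swapPlane '' F) (C' * h ^ (-s')) := by
      simpa [wordScale, strip] using hone' [] h w hh hhB hw1
    refine h0.of_swapPlane.mono Subset.rfl le_rfl le_rfl ?_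
    have h2 : 0 ≤ C' * h ^ (-s') := by positivity
    calc C' * h ^ (-s') ≤ C' * h ^ (-s') * (B ^ t' * w ^ (-t')) :=
          le_mul_of_one_le_right h2 (hpow hw hwB ht0')
      _ = C' * B ^ t' * (h ^ (-s') * w ^ (-t')) := by ring
      _ ≤ A * G w h := mul_le_mul (le_add_of_nonneg_left (by positivity))
          (le_add_of_nonneg_left (by positivity)) (by positivity) hA0.le
  have hsum' : ∑ i, S.d i ^ s' * S.c i ^ t' ≤ 1 := T'.sum_mul_le_one hs' ht'
  have hwhole : ∀ w h, 0 < w → w ≤ B → 0 < h → h ≤ B → True →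
      RectCover w h F (A * G w h) := by
    intro w h hw hwB hh hhB hwh
    refine hF.rectCover (D := fun _ _ => True) hA0.le hB (fun _ _ _ _ _ => trivial) ?_ ?_
      hw hwB hh hhB trivial
    · intro w h hw hh
      simp only [hG]
      calc ∑ i, ((w / S.c i) ^ (-s) * (h / S.d i) ^ (-t)
              + (h / S.d i) ^ (-s') * (w / S.c i) ^ (-t'))
          = (∑ i, S.c i ^ s * S.d i ^ t) * (w ^ (-s) * h ^ (-t))
            + (∑ i, S.d i ^ s' * S.c i ^ t') * (h ^ (-s') * w ^ (-t')) := by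
            rw [Finset.sum_mul, Finset.sum_mul, ← Finset.sum_add_distrib]
            refine Finset.sum_congr rfl fun i _ => ?_
            rw [div_rpow_neg hw (S.c_mem i).1, div_rpow_neg hh (S.d_mem i).1,
              div_rpow_neg hw (S.c_mem i).1, div_rpow_neg hh (S.d_mem i).1]
            ring
        _ ≤ _ := add_le_add (mul_le_of_le_one_left (by positivity) (T.sum_mul_le_one hs ht))
            (mul_le_of_le_one_left (by positivity) hsum')
    · intro w h hw hwB hh hhB _ h1
      rcases h1 with h1 | h1
      · exact hbase' w h hw h1 hwB hh hhB
      · simpa [wordScale, strip] using hbase [] w h hw hwB h1 hhB trivial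
  have hcol : ∀ k, ∑ i with T.col i = k, S.d i ^ s' ≤ 1 := by
    intro k
    rw [← hs']
    calc ∑ i with T.col i = k, S.d i ^ s'
        = ∑ k' ∈ (Finset.univ.filter fun i => T.col i = k).image T'.col, T'.width k' ^ s' := by
          rw [Finset.sum_image]
          · exact Finset.sum_congr rfl fun i _ => by rw [T'.width_col]; rfl
          · intro i hi j hj hij
            exact hTT i j ((Finset.mem_filter.1 hi).2.trans (Finset.mem_filter.1 hj).2.symm) hij
      _ ≤ ∑ k', T'.width k' ^ s' :=
          Finset.sum_le_sum_of_subset_of_nonneg (Finset.subset_univ _)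
            fun k' _ _ => Real.rpow_nonneg (T'.width_mem k').1.le _
  refine ⟨A * 2, by positivity, fun ω ρ hρ hρ1 => ?_⟩
  have := T.rectCover_strip (F := F) (G := G) (D := fun _ _ => True) (B := B) (C := A)
    hA0.le (fun i => (hB i).2) (fun _ _ _ _ _ => trivial) ?_ hbase hwhole ω hρ (hρ1.trans hB1) hρ
    (hρ1.trans hB1) trivial
  · refine this.mono Subset.rfl le_rfl le_rfl ?_
    rw [mul_assoc]
    refine mul_le_mul_of_nonneg_left ?_ hA0.le
    simp only [hG]
    rw [← Real.rpow_add hρ, ← Real.rpow_add hρ, two_mul]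
    refine add_le_add ?_ ?_ <;>
      exact Real.rpow_le_rpow_of_exponent_ge hρ hρ1 (by linarith)
  · intro k w h hw hh
    simp only [hG]
    calc ∑ i with T.col i = k, (w ^ (-s) * (h / S.d i) ^ (-t)
            + (h / S.d i) ^ (-s') * w ^ (-t'))
        = (∑ i with T.col i = k, S.d i ^ t) * (w ^ (-s) * h ^ (-t))
          + (∑ i with T.col i = k, S.d i ^ s') * (h ^ (-s') * w ^ (-t')) := by
          rw [Finset.sum_mul, Finset.sum_mul, ← Finset.sum_add_distrib]
          refine Finset.sum_congr rfl fun i _ => ?_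
          rw [div_rpow_neg hh (S.d_mem i).1, div_rpow_neg hh (S.d_mem i).1]
          ring
      _ ≤ _ := add_le_add (mul_le_of_le_one_left (by positivity) (ht k))
          (mul_le_of_le_one_left (by positivity) (hcol k))

/-- In a ball of radius `R`, the image of `F` in a rectangle of height about `R`, at least as wide
as high, looks like boundedly many strips. -/
theorem StripBound.exists_rectCover_wordMap [Fintype I] [Fintype K] {T : S.Columns K} {α : ℝ}
    (h : T.StripBound F α) (hF : S.IsAttractor F) {κ : ℝ} (hκ : 0 < κ) :
    ∃ C > 0, ∀ (r R : ℝ) (x : EuclideanSpace ℝ (Fin 2)) (w : List I), 0 < r → r < R →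
      κ * R ≤ wordScale S.d w → wordScale S.d w ≤ R → wordScale S.d w ≤ wordScale S.c w →
      RectCover (r / 4) (r / 4) (S.wordMap w '' F ∩ Metric.closedBall x R)
        (C * (R / r) ^ α) := by
  classical
  obtain ⟨C, hC, hcov⟩ := h
  obtain ⟨κ', l, hκ', hκ1', hl0, hl, hκl⟩ := exists_uniform_bounds T.width_mem
  -- the two terms stand for the cases `R ≤ c(w)` and `c(w) ≤ R` in the packing argument
  set L := ⌈max (1 / κ') (1 / (κ' * κ))⌉₊ with hL
  have hL1 : 1 ≤ L * κ' := by
    rw [← div_le_iff₀ hκ']; exact (le_max_left _ _).trans (Nat.le_ceil _)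
  have hL2 : 1 ≤ L * (κ' * κ) := by
    rw [← div_le_iff₀ (by positivity)]; exact (le_max_right _ _).trans (Nat.le_ceil _)
  refine ⟨((2 * L + 4) ^ 2 : ℕ) * (C * 4 ^ α), by positivity, ?_⟩
  intro r R x w hr hrR hd1 hd2 hdc
  have hR : 0 < R := hr.trans hrR
  have hw := wordScale_pos (fun i => (S.c_mem i).1) w
  have hδ : 0 < min 1 (R / wordScale S.c w) := lt_min one_pos (div_pos hR hw)
  obtain ⟨Ω, hΩ, hΩs⟩ := exists_cut_line hκ' hκ1' hl hδ (min_le_left _ _) hκl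
  set Ω' := Ω.filter fun ω => ∃ p ∈ T.strip F ω, S.wordMap w p ∈ Metric.closedBall x R with hΩ'
  have hcard : Ω'.card ≤ (2 * L + 4) ^ 2 := by
    have hp : ∀ ω ∈ Ω', ∃ p ∈ T.strip F ω, S.wordMap w p ∈ Metric.closedBall x R :=
      fun ω hω => (Finset.mem_filter.1 hω).2
    choose! p hp1 hp2 using hp
    refine card_le_of_apart_line (e := κ' * min 1 (R / wordScale S.c w))
      (R := R / wordScale S.c w) (x := (x 0 - wordShift S.c S.a w) / wordScale S.c w) Ω'
      (a := wordShift T.width T.left) (c := wordScale T.width) (p := fun ω => p ω 0)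
      (by positivity) ?_ (fun ω hω => (hΩs ω (Finset.mem_filter.1 hω).1).1) ?_ ?_
    · rcases min_choice 1 (R / wordScale S.c w) with hm | hm <;> rw [hm]
      · rw [mul_one, div_le_iff₀ hw]
        have h1 : κ * R ≤ wordScale S.c w := hd1.trans hdc
        have h2 := mul_le_mul_of_nonneg_left h1 (by positivity : 0 ≤ L * κ')
        nlinarith
      · rw [← mul_assoc]
        exact le_mul_of_one_le_left (div_pos hR hw).le hL1
    · intro v hv u hu hvu
      exact hΩ.apart_line T.mapsUnit_width T.apart_columns (Finset.mem_filter.1 hv).1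
        (Finset.mem_filter.1 hu).1 hvu
    · intro ω hω
      obtain ⟨y, hy, hpy⟩ := T.exists_of_mem_strip (hp1 ω hω)
      have h1 := affine_mem_Icc (a := wordShift T.width T.left ω)
        (wordScale_pos (fun k => (T.width_mem k).1) ω).le (T.axisProj_subset hF hy)
      rw [← hpy] at h1
      refine ⟨h1.1, h1.2, ?_⟩
      have h2 := (abs_sub_apply_le_dist _ _ 0).trans (Metric.mem_closedBall.1 (hp2 ω hω))
      rw [wordMap_zero] at h2
      have e : p ω 0 - (x 0 - wordShift S.c S.a w) / wordScale S.c w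
          = (wordScale S.c w * p ω 0 + wordShift S.c S.a w - x 0) / wordScale S.c w := by
        field_simp
        ring
      rw [e, abs_div, abs_of_pos hw]
      exact div_le_div_of_nonneg_right h2 hw.le
  have hpiece : ∀ ω ∈ Ω', RectCover (r / 4) (r / 4) (S.wordMap w '' T.strip F ω)
      (C * (r / R / 4) ^ (-α)) := by
    intro ω hω
    have hρ : 0 < r / R / 4 := by positivity
    have hρ1 : r / R / 4 ≤ 1 := by
      have : r / R ≤ 1 := (div_le_one hR).2 hrR.le
      linarith
    refine RectCover.wordMap S w ((hcov ω _ hρ hρ1).mono Subset.rfl ?_ ?_ le_rfl)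
    · have h1 : wordScale T.width ω ≤ R / wordScale S.c w :=
        (hΩs ω (Finset.mem_filter.1 hω).1).2.trans (min_le_right _ _)
      calc r / R / 4 * wordScale T.width ω ≤ r / R / 4 * (R / wordScale S.c w) :=
            mul_le_mul_of_nonneg_left h1 hρ.le
        _ = _ := by field_simp
    · rw [le_div_iff₀ (wordScale_pos (fun i => (S.d_mem i).1) w)]
      calc r / R / 4 * wordScale S.d w ≤ r / R / 4 * R := mul_le_mul_of_nonneg_left hd2 hρ.le
        _ = _ := by field_simp
  refine (RectCover.biUnion Ω' hpiece).mono ?_ le_rfl le_rfl ?_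
  · rintro _ ⟨⟨p, hp, rfl⟩, hpx⟩
    obtain ⟨ω, hω, hpω⟩ := T.exists_mem_strip hF hΩ hp
    exact mem_iUnion₂.2 ⟨ω, Finset.mem_filter.2 ⟨hω, p, hpω, hpx⟩, p, hpω, rfl⟩
  · rw [Finset.sum_const, nsmul_eq_mul, div_rpow_neg (by positivity) four_pos,
      Real.rpow_neg (by positivity), ← Real.inv_rpow (by positivity), inv_div, mul_assoc,
      mul_assoc]
    exact mul_le_mul_of_nonneg_right (by exact_mod_cast hcard) (by positivity)

/-- Bounds for the images of `F` in rectangles with shorter side about `R`, within a ball of radius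
`R`, add up: such a ball meets boundedly many of these rectangles. -/
theorem assouadDim_le [Fintype I] (T : S.Columns K) (hF : S.IsAttractor F) {α : ℝ}
    (h : ∀ κ > 0, ∃ C > 0, ∀ (r R : ℝ) (x : EuclideanSpace ℝ (Fin 2)) (w : List I), 0 < r → r < R →
      κ * R ≤ min (wordScale S.c w) (wordScale S.d w) →
      min (wordScale S.c w) (wordScale S.d w) ≤ R →
      RectCover (r / 4) (r / 4) (S.wordMap w '' F ∩ Metric.closedBall x R)
        (C * (R / r) ^ α)) : assouadDim F ≤ (α : EReal) := by
  classical
  obtain ⟨κ₁, l₁, hκ₁, hκ1₁, -, hl₁, hκl₁⟩ := exists_uniform_bounds S.c_mem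
  obtain ⟨κ₂, l₂, hκ₂, hκ1₂, -, hl₂, hκl₂⟩ := exists_uniform_bounds S.d_mem
  set κ := min κ₁ κ₂ with hκdef
  have hκ : 0 < κ := lt_min hκ₁ hκ₂
  obtain ⟨C, hC, hcov⟩ := h κ hκ
  set L := ⌈1 / κ⌉₊
  have hL1 : 1 ≤ L * κ := by
    rw [← div_le_iff₀ hκ]; exact Nat.le_ceil _
  refine sInf_le ⟨α, ⟨((2 * L + 4) ^ 2 : ℕ) * C, by positivity, 1, one_pos, ?_⟩, rfl⟩
  intro r R hr hrR hR1 x _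
  have hR : 0 < R := hr.trans hrR
  obtain ⟨W, hW, hWs⟩ := exists_cut (c := S.c) (d := S.d) (l := max l₁ l₂) hκ
    ((min_le_left _ _).trans hκ1₁) (max_lt hl₁ hl₂) hR hR1
    (fun i => ⟨(min_le_left _ _).trans (hκl₁ i).1, (hκl₁ i).2.trans (le_max_left _ _)⟩)
    (fun i => ⟨(min_le_right _ _).trans (hκl₂ i).1, (hκl₂ i).2.trans (le_max_right _ _)⟩)
  set W' := W.filter fun w => ∃ p ∈ F, S.wordMap w p ∈ Metric.closedBall x R with hW'
  have hcard : W'.card ≤ (2 * L + 4) ^ 2 := by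
    have hp : ∀ w ∈ W', ∃ p ∈ F, S.wordMap w p ∈ Metric.closedBall x R :=
      fun w hw => (Finset.mem_filter.1 hw).2
    choose! p hp1 hp2 using hp
    refine card_le_of_apart (e := κ * R) (R := R) (x := x 0) (y := x 1) W'
      (a := wordShift S.c S.a) (c := wordScale S.c) (b := wordShift S.d S.b) (d := wordScale S.d)
      (p := fun w => S.wordMap w (p w) 0) (q := fun w => S.wordMap w (p w) 1)
      (by positivity) ?_ ?_ ?_ ?_ ?_ ?_
    · rw [← mul_assoc]
      exact le_mul_of_one_le_left hR.le hL1
    · exact fun w hw => (hWs w (Finset.mem_filter.1 hw).1).1.trans (min_le_left _ _)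
    · exact fun w hw => (hWs w (Finset.mem_filter.1 hw).1).1.trans (min_le_right _ _)
    · intro v hv w hw hvw
      exact hW.apart T.mapsUnit_fst T.mapsUnit_snd T.apart (Finset.mem_filter.1 hv).1
        (Finset.mem_filter.1 hw).1 hvw
    · intro w hw
      have h1 := affine_mem_Icc (a := wordShift S.c S.a w)
        (wordScale_pos (fun i => (S.c_mem i).1) w).le (hF.mem_Icc_zero T.mapsUnit_fst (hp1 w hw))
      rw [← wordMap_zero] at h1
      exact ⟨h1.1, h1.2, (abs_sub_apply_le_dist _ _ 0).trans (hp2 w hw)⟩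
    · intro w hw
      have h1 := affine_mem_Icc (a := wordShift S.d S.b w)
        (wordScale_pos (fun i => (S.d_mem i).1) w).le (hF.mem_Icc_one T.mapsUnit_snd (hp1 w hw))
      rw [← wordMap_one] at h1
      exact ⟨h1.1, h1.2, (abs_sub_apply_le_dist _ _ 1).trans (hp2 w hw)⟩
  refine RectCover.openCoverNumber_le hr ((RectCover.biUnion W' fun w hw =>
    hcov r R x w hr hrR (hWs w (Finset.mem_filter.1 hw).1).1
      (hWs w (Finset.mem_filter.1 hw).1).2).mono ?_ le_rfl le_rfl ?_)
  · rintro p ⟨hpx, hp⟩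
    obtain ⟨w, hw, q, hq, rfl⟩ := hF.exists_wordMap hW hp
    exact mem_iUnion₂.2 ⟨w, Finset.mem_filter.2 ⟨hw, q, hq, hpx⟩, ⟨q, hq, rfl⟩, hpx⟩
  · rw [Finset.sum_const, nsmul_eq_mul, mul_assoc]
    exact mul_le_mul_of_nonneg_right (by exact_mod_cast hcard) (by positivity)

theorem assouadDim_le_of_horizontal [Fintype I] [Fintype K] [DecidableEq K] (T : S.Columns K)
    (hF : S.IsAttractor F) (hS : S.IsHorizontal) {s t : ℝ} (hs0 : 0 ≤ s)
    (hs : ∑ k, T.width k ^ s = 1) (ht0 : 0 ≤ t)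
    (ht : ∀ k, ∑ i with T.col i = k, S.d i ^ t ≤ 1) :
    assouadDim F ≤ ((s + t : ℝ) : EReal) := by
  refine T.assouadDim_le hF fun κ hκ => ?_
  obtain ⟨C, hC, h⟩ := (T.stripBound_of_horizontal hF hS hs0 hs ht0 ht).exists_rectCover_wordMap hF
    hκ
  refine ⟨C, hC, fun r R x w hr hrR h1 h2 => ?_⟩
  have hdc : wordScale S.d w ≤ wordScale S.c w := by
    clear h1 h2
    induction w with
    | nil => exact le_rfl
    | cons i w ih =>
      exact mul_le_mul (hS i) ih (wordScale_pos (fun i => (S.d_mem i).1) w).le (S.c_mem i).1.le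
  rw [min_eq_right hdc] at h1 h2
  exact h r R x w hr hrR h1 h2 hdc

theorem assouadDim_le_of_grid [Fintype I] {K' : Type*} [Fintype K] [DecidableEq K] [Fintype K']
    [DecidableEq K'] (T : S.Columns K) (T' : S.swap.Columns K')
    (hTT : ∀ i j, T.col i = T.col j → T'.col i = T'.col j → i = j)
    (hF : S.IsAttractor F) {s t s' t' α : ℝ} (hs0 : 0 ≤ s)
    (hs : ∑ k, T.width k ^ s = 1) (ht0 : 0 ≤ t)
    (ht : ∀ k, ∑ i with T.col i = k, S.d i ^ t ≤ 1) (hs0' : 0 ≤ s')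
    (hs' : ∑ k, T'.width k ^ s' = 1) (ht0' : 0 ≤ t')
    (ht' : ∀ k, ∑ i with T'.col i = k, S.c i ^ t' ≤ 1) (hα : s + t ≤ α) (hα' : s' + t' ≤ α) :
    assouadDim F ≤ (α : EReal) := by
  have hFF : swapPlane '' (swapPlane '' F) = F := by
    simp only [image_image, swapPlane_swapPlane, image_id']
  refine T.assouadDim_le hF fun κ hκ => ?_
  obtain ⟨C, hC, h⟩ := (T.stripBound_of_grid T' hTT hF hs0 hs ht0 ht hs0' hs' ht0' ht' hα
    hα').exists_rectCover_wordMap hF hκ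
  obtain ⟨C', hC', h'⟩ := (T'.stripBound_of_grid (F := swapPlane '' F) (S := S.swap) T
    (fun i j h1 h2 => hTT i j h2 h1) hF.swap hs0' hs' ht0' ht' hs0 hs ht0 ht hα'
    hα).exists_rectCover_wordMap hF.swap hκ
  refine ⟨C + C', by positivity, fun r R x w hr hrR h1 h2 => ?_⟩
  have hpow : 0 ≤ (R / r) ^ α := Real.rpow_nonneg (div_pos (hr.trans hrR) hr).le _
  rcases le_total (wordScale S.d w) (wordScale S.c w) with hdc | hdc
  · rw [min_eq_right hdc] at h1 h2
    refine (h r R x w hr hrR h1 h2 hdc).mono Subset.rfl le_rfl le_rfl ?_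
    exact mul_le_mul_of_nonneg_right (by linarith) hpow
  · rw [min_eq_left hdc] at h1 h2
    refine RectCover.of_swapPlane ((h' r R (swapPlane x) w hr hrR h1 h2 hdc).mono ?_ le_rfl le_rfl
      (mul_le_mul_of_nonneg_right (by linarith) hpow))
    rintro _ ⟨_, ⟨⟨p, hp, rfl⟩, hpx⟩, rfl⟩
    refine ⟨⟨swapPlane p, ⟨p, hp, rfl⟩, swap_wordMap w p⟩, ?_⟩
    rw [Metric.mem_closedBall, swapPlane.dist_eq]
    exact hpx

end Columns

end DiagonalIFS

/-! ### Carpets -/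

namespace DiagonalIFS

variable {I K : Type*} {S : DiagonalIFS I} {F : Set (EuclideanSpace ℝ (Fin 2))}

theorem IsDivision.mem_Icc {m : ℕ} {x : Fin (m + 1) → ℝ} (hx : IsDivision x) (k : Fin (m + 1)) :
    x k ∈ Icc (0 : ℝ) 1 := by
  rw [← hx.2.1, ← hx.2.2]
  exact ⟨hx.1.monotone (Fin.zero_le k), hx.1.monotone (Fin.le_last k)⟩

theorem IsDivision.apart {m : ℕ} {x : Fin (m + 1) → ℝ} (hx : IsDivision x) {k l : Fin m}
    (hkl : k ≠ l) :
    Apart (x k.castSucc) (x k.succ - x k.castSucc) (x l.castSucc) (x l.succ - x l.castSucc) := by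
  simp only [Apart, add_sub_cancel]
  rcases lt_or_gt_of_ne hkl with h | h
  · exact Or.inl (hx.1.monotone (Fin.succ_le_castSucc_iff.2 h))
  · exact Or.inr (hx.1.monotone (Fin.succ_le_castSucc_iff.2 h))

theorem IsDivision.exists_columns {m : ℕ} {x : Fin (m + 1) → ℝ} (hx : IsDivision x)
    (κ : I → Fin m) (ha : ∀ i, S.a i = x (κ i).castSucc) (hc : ∀ i, S.a i + S.c i = x (κ i).succ)
    (hd : MapsUnit S.d S.b)
    (hcol : ∀ i j, i ≠ j → κ i = κ j → Apart (S.b i) (S.d i) (S.b j) (S.d j)) :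
    ∃ T : S.Columns (Set.range κ), ∀ i, (T.col i : Fin m) = κ i := by
  refine ⟨⟨fun i => ⟨κ i, i, rfl⟩, fun k => x k.1.succ - x k.1.castSucc, fun k => x k.1.castSucc,
    ?_, ?_, fun i => (ha i).symm, ?_, hd, ?_, ?_⟩, fun i => rfl⟩
  · rintro ⟨_, i, rfl⟩
    exact ⟨i, rfl⟩
  · intro i
    simp only
    rw [← hc, ← ha]
    ring
  · intro i
    refine ⟨(S.c_mem i).1, ?_, ?_⟩
    · rw [ha]; exact (hx.mem_Icc _).1
    · rw [hc]; exact (hx.mem_Icc _).2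
  · intro k l hkl
    exact hx.apart fun h => hkl (Subtype.ext h)
  · intro i j hij h
    exact hcol i j hij (congrArg Subtype.val h)

theorem IsExtendedLalleyGatzouras.isHorizontal (h : S.IsExtendedLalleyGatzouras) :
    S.IsHorizontal := by
  obtain ⟨_, _, _, _, _, _, _, _, _, h⟩ := h
  exact fun i => (h i).2

theorem IsExtendedLalleyGatzouras.exists_columns (h : S.IsExtendedLalleyGatzouras) :
    ∃ (m : ℕ) (κ : I → Fin m), Nonempty (S.Columns (Set.range κ)) := by
  obtain ⟨m, x, n, y, cell, -, hx, hy, hinj, h⟩ := h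
  have hb : ∀ i, S.b i = y (cell i).1 (cell i).2.castSucc := fun i => (h i).1.2.2.1
  have hd : ∀ i, S.b i + S.d i = y (cell i).1 (cell i).2.succ := fun i => (h i).1.2.2.2
  have hd' : ∀ i, S.d i = y (cell i).1 (cell i).2.succ - y (cell i).1 (cell i).2.castSucc := by
    intro i
    rw [← hd, ← hb]
    ring
  have hdb : MapsUnit S.d S.b := fun i => ⟨(S.d_mem i).1,
    ((hy _).mem_Icc _).1.trans_eq (hb i).symm, (hd i).trans_le ((hy _).mem_Icc _).2⟩
  have hcol : ∀ i j, i ≠ j → (cell i).1 = (cell j).1 →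
      Apart (S.b i) (S.d i) (S.b j) (S.d j) := by
    intro i j hij hκ
    rw [hd' i, hd' j, hb i, hb j]
    have hne : cell i ≠ cell j := fun h => hij (hinj h)
    generalize cell i = u at *
    generalize cell j = v at *
    obtain ⟨k, u⟩ := u
    obtain ⟨k', v⟩ := v
    obtain rfl : k = k' := hκ
    exact (hy k).apart fun huv => hne (congrArg (Sigma.mk k) huv)
  obtain ⟨T, -⟩ := hx.exists_columns (fun i => (cell i).1) (fun i => (h i).1.1)
    (fun i => (h i).1.2.1) hdb hcol
  exact ⟨m, _, ⟨T⟩⟩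

theorem IsBaranski.swap (h : S.IsBaranski) : S.swap.IsBaranski := by
  obtain ⟨m, n, x, y, cell, hm, hn, hx, hy, hinj, h⟩ := h
  exact ⟨n, m, y, x, fun i => (cell i).swap, hn, hm, hy, hx, Prod.swap_injective.comp hinj,
    fun i => ⟨(h i).2.2.1, (h i).2.2.2, (h i).1, (h i).2.1⟩⟩

theorem IsBaranski.exists_columns (h : S.IsBaranski) :
    ∃ (m n : ℕ) (κ : I → Fin m) (ρ : I → Fin n) (T : S.Columns (Set.range κ))
      (T' : S.swap.Columns (Set.range ρ)),
      ∀ i j, T.col i = T.col j → T'.col i = T'.col j → i = j := by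
  obtain ⟨m, n, x, y, cell, -, -, hx, hy, hinj, h⟩ := h
  have ha : ∀ i, S.a i = x (cell i).1.castSucc := fun i => (h i).1
  have hc : ∀ i, S.a i + S.c i = x (cell i).1.succ := fun i => (h i).2.1
  have hb : ∀ i, S.b i = y (cell i).2.castSucc := fun i => (h i).2.2.1
  have hd : ∀ i, S.b i + S.d i = y (cell i).2.succ := fun i => (h i).2.2.2
  have hc' : ∀ i, S.c i = x (cell i).1.succ - x (cell i).1.castSucc := by
    intro i
    rw [← hc, ← ha]
    ring
  have hd' : ∀ i, S.d i = y (cell i).2.succ - y (cell i).2.castSucc := by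
    intro i
    rw [← hd, ← hb]
    ring
  obtain ⟨T, hT⟩ := hx.exists_columns (S := S) (fun i => (cell i).1) ha hc
    (fun i => ⟨(S.d_mem i).1, (hy.mem_Icc _).1.trans_eq (hb i).symm,
      (hd i).trans_le (hy.mem_Icc _).2⟩)
    (fun i j hij hκ => by
      rw [hd' i, hd' j, hb i, hb j]
      exact hy.apart fun huv => hij (hinj (Prod.ext hκ huv)))
  obtain ⟨T', hT'⟩ := hy.exists_columns (S := S.swap) (fun i => (cell i).2) hb hd
    (fun i => ⟨(S.c_mem i).1, (hx.mem_Icc _).1.trans_eq (ha i).symm,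
      (hc i).trans_le (hx.mem_Icc _).2⟩)
    (fun i j hij hκ => by
      change Apart (S.a i) (S.c i) (S.a j) (S.c j)
      rw [hc' i, hc' j, ha i, ha j]
      exact hx.apart fun huv => hij (hinj (Prod.ext huv hκ)))
  refine ⟨m, n, _, _, T, T', fun i j h1 h2 => hinj (Prod.ext ?_ ?_)⟩
  · simpa [hT] using congrArg Subtype.val h1
  · simpa [hT'] using congrArg Subtype.val h2

theorem dist_map_map_of_eq {i : I} (h : S.c i = S.d i) (p q : EuclideanSpace ℝ (Fin 2)) :
    dist (S.map i p) (S.map i q) = S.c i * dist p q := by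
  have e : S.map i p - S.map i q = S.c i • (p - q) := by
    rw [PiLp.ext_iff, Fin.forall_fin_two]
    constructor
    · simp; ring
    · simp [← h]; ring
  rw [dist_eq_norm, dist_eq_norm, e, norm_smul, Real.norm_of_nonneg (S.c_mem i).1.le]

/-- The exponents `s` of the projection and `t i` of the slices. -/
theorem Columns.exists_exponents [Fintype I] [Nonempty I] [Fintype K] [DecidableEq K]
    (T : S.Columns K) (hF : S.IsAttractor F) : ∃ (s : ℝ) (t : I → ℝ), 0 ≤ s ∧
      ∑ k, T.width k ^ s = 1 ∧ HasBoxDim (axisProj 0 F) s ∧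
      (∀ i, HasBoxDim (S.slice F 0 i) (t i)) ∧ (∀ i, 0 ≤ t i) ∧
      (∀ i, ∑ j : {j // T.col j = T.col i}, S.d j ^ t i = 1) ∧
      ∀ u, (∀ i, t i ≤ u) → ∀ k, ∑ i with T.col i = k, S.d i ^ u ≤ 1 := by
  have : Nonempty K := ⟨T.col (Classical.arbitrary I)⟩
  obtain ⟨s, hs0, hs⟩ := exists_moran_exponent T.width_mem
  have ht : ∀ i, ∃ t : ℝ, 0 ≤ t ∧ ∑ j : {j // T.col j = T.col i}, S.d j ^ t = 1 := by
    intro i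
    have : Nonempty {j // T.col j = T.col i} := ⟨⟨i, rfl⟩⟩
    exact exists_moran_exponent fun j => S.d_mem j
  choose t ht0 ht using ht
  refine ⟨s, t, hs0, hs, T.hasBoxDim_axisProj hF hs0 hs,
    fun i => T.hasBoxDim_slice hF i (ht0 i) (ht i), ht0, ht, fun u hu k => ?_⟩
  obtain ⟨i, rfl⟩ := T.col_surjective k
  rw [← ht i, Finset.sum_subtype (p := fun j => T.col j = T.col i) _ (by simp)]
  exact Finset.sum_le_sum fun j _ =>
    Real.rpow_le_rpow_of_exponent_ge (S.d_mem j).1 (S.d_mem j).2.le (hu i)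

theorem exists_assouadDim_eq_of_horizontal [Fintype I] [Nonempty I]
    (hS : S.IsExtendedLalleyGatzouras ∨ S.swap.IsExtendedLalleyGatzouras ∨ S.IsBaranski)
    (hne : ∃ i, S.c i ≠ S.d i) (hF : S.IsAttractor F) (hh : S.IsHorizontal) :
    ∃ (s : ℝ) (t : I → ℝ),
      HasBoxDim (axisProj 0 F) s ∧ (∀ i, HasBoxDim (S.slice F 0 i) (t i)) ∧
      assouadDim F = ((s + Finset.univ.sup' Finset.univ_nonempty t : ℝ) : EReal) := by
  classical
  obtain ⟨j, hj⟩ := hne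
  have hT : ∃ (m : ℕ) (κ : I → Fin m), Nonempty (S.Columns (Set.range κ)) := by
    rcases hS with h | h | h
    · exact h.exists_columns
    · exact absurd (le_antisymm (h.isHorizontal j) (hh j)) hj
    · obtain ⟨m, n, κ, ρ, T, -, -⟩ := h.exists_columns
      exact ⟨m, κ, ⟨T⟩⟩
  obtain ⟨m, κ, ⟨T⟩⟩ := hT
  obtain ⟨s, t, hs0, hs, hbs, hbt, ht0, ht, hu⟩ := T.exists_exponents hF
  refine ⟨s, t, hbs, hbt, le_antisymm ?_ ?_⟩
  · refine T.assouadDim_le_of_horizontal hF hh hs0 hs ?_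
      (hu _ fun i => Finset.le_sup' t (Finset.mem_univ i))
    exact (ht0 j).trans (Finset.le_sup' t (Finset.mem_univ j))
  · obtain ⟨i, -, hi⟩ := Finset.exists_mem_eq_sup' Finset.univ_nonempty t
    rw [hi]
    exact T.le_assouadDim hF hs0 hs (lt_of_le_of_ne (hh j) hj.symm) (T.col i) (ht0 i) (ht i)

theorem _root_.HasBoxDim.of_swapPlane {A : Set (EuclideanSpace ℝ (Fin 2))} {s : ℝ}
    (h : HasBoxDim (swapPlane '' A) s) : HasBoxDim A s := by
  simpa only [image_image, swapPlane_swapPlane, image_id'] using h.image swapPlane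

end DiagonalIFS

theorem theorem2p8 {I : Type*} [Fintype I] [Nontrivial I] (S : DiagonalIFS I)
    (hS : S.IsCarpetSystem) (F : Set (EuclideanSpace ℝ (Fin 2))) (hF : S.IsAttractor F) :
    (S.IsHorizontal → ∃ (s : ℝ) (t : I → ℝ),
      HasBoxDim (axisProj 0 F) s ∧ (∀ i, HasBoxDim (S.slice F 0 i) (t i)) ∧
      assouadDim F = ((s + Finset.univ.sup' Finset.univ_nonempty t : ℝ) : EReal)) ∧
    (S.IsVertical → ∃ (s : ℝ) (t : I → ℝ),
      HasBoxDim (axisProj 1 F) s ∧ (∀ i, HasBoxDim (S.slice F 1 i) (t i)) ∧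
      assouadDim F = ((s + Finset.univ.sup' Finset.univ_nonempty t : ℝ) : EReal)) ∧
    (S.IsMixed → ∃ (s : Fin 2 → ℝ) (t : Fin 2 → I → ℝ),
      (∀ j, HasBoxDim (axisProj j F) (s j)) ∧ (∀ j i, HasBoxDim (S.slice F j i) (t j i)) ∧
      assouadDim F = ((Finset.univ.sup' Finset.univ_nonempty
        (fun i : I => Finset.univ.sup' Finset.univ_nonempty
          (fun j : Fin 2 => s j + t j i)) : ℝ) : EReal)) := by
  classical
  obtain ⟨hclass, i₀, hi₀⟩ := hS
  have hne : ∃ i, S.c i ≠ S.d i :=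
    ⟨i₀, fun h => hi₀ ⟨S.c i₀, fun p q => DiagonalIFS.dist_map_map_of_eq h p q⟩⟩
  refine ⟨DiagonalIFS.exists_assouadDim_eq_of_horizontal hclass hne hF, fun hv => ?_, fun hm => ?_⟩
  · obtain ⟨s, t, hs, ht, hdim⟩ := DiagonalIFS.exists_assouadDim_eq_of_horizontal (S := S.swap)
      (F := swapPlane '' F)
      (by
        rcases hclass with h | h | h
        · exact Or.inr (Or.inl h)
        · exact Or.inl h
        · exact Or.inr (Or.inr h.swap))
      (hne.imp fun i hi => hi.symm) hF.swap hv
    rw [DiagonalIFS.axisProj_swapPlane_zero] at hs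
    rw [assouadDim_image] at hdim
    exact ⟨s, t, hs,
      fun i => HasBoxDim.of_swapPlane (DiagonalIFS.slice_swap_zero S F i ▸ ht i), hdim⟩
  · have hB : S.IsBaranski := by
      rcases hclass with h | h | h
      · exact absurd h.isHorizontal hm.1
      · exact absurd h.isHorizontal hm.2
      · exact h
    obtain ⟨m, n, κ, ρ, T, T', hTT⟩ := hB.exists_columns
    obtain ⟨s, t, hs0, hs, hbs, hbt, ht0, ht, hu⟩ := T.exists_exponents hF
    obtain ⟨s', t', hs0', hs', hbs', hbt', ht0', ht', hu'⟩ := T'.exists_exponents hF.swap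
    rw [DiagonalIFS.axisProj_swapPlane_zero] at hbs'
    refine ⟨![s, s'], ![t, t'], Fin.forall_fin_two.2 ⟨hbs, hbs'⟩, Fin.forall_fin_two.2
      ⟨hbt, fun i => HasBoxDim.of_swapPlane (DiagonalIFS.slice_swap_zero S F i ▸ hbt' i)⟩, ?_⟩
    have hlow : ∀ i j, ((![s, s'] j + ![t, t'] j i : ℝ) : EReal) ≤ assouadDim F := by
      obtain ⟨j, hj⟩ := not_forall.1 hm.1
      obtain ⟨j', hj'⟩ := not_forall.1 hm.2
      intro i
      refine Fin.forall_fin_two.2 ⟨?_, ?_⟩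
      · exact T.le_assouadDim hF hs0 hs (not_le.1 hj') (T.col i) (ht0 i) (ht i)
      · rw [← assouadDim_image swapPlane]
        exact T'.le_assouadDim hF.swap hs0' hs' (not_le.1 hj) (T'.col i) (ht0' i) (ht' i)
    have hupp : ∀ i j, ![s, s'] j + ![t, t'] j i ≤ Finset.univ.sup' Finset.univ_nonempty
        (fun i : I => Finset.univ.sup' Finset.univ_nonempty
          (fun j : Fin 2 => ![s, s'] j + ![t, t'] j i)) := fun i j =>
      (Finset.le_sup' (fun j : Fin 2 => ![s, s'] j + ![t, t'] j i) (Finset.mem_univ j)).trans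
        (Finset.le_sup' (fun i : I => Finset.univ.sup' Finset.univ_nonempty
          (fun j : Fin 2 => ![s, s'] j + ![t, t'] j i)) (Finset.mem_univ i))
    refine le_antisymm ?_ ?_
    · obtain ⟨i, -, hi⟩ := Finset.exists_mem_eq_sup' Finset.univ_nonempty t
      obtain ⟨i', -, hi'⟩ := Finset.exists_mem_eq_sup' Finset.univ_nonempty t'
      exact T.assouadDim_le_of_grid T' hTT hF hs0 hs (ht0 i)
        (hu _ fun l => hi ▸ Finset.le_sup' t (Finset.mem_univ l)) hs0' hs' (ht0' i')
        (hu' _ fun l => hi' ▸ Finset.le_sup' t' (Finset.mem_univ l)) (hupp i 0) (hupp i' 1)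
    · obtain ⟨i, -, hi⟩ := Finset.exists_mem_eq_sup' Finset.univ_nonempty
        (fun i : I => Finset.univ.sup' Finset.univ_nonempty
          (fun j : Fin 2 => ![s, s'] j + ![t, t'] j i))
      obtain ⟨j, -, hj⟩ := Finset.exists_mem_eq_sup' Finset.univ_nonempty
        (fun j : Fin 2 => ![s, s'] j + ![t, t'] j i)
      rw [hi, hj]
      exact hlow i j
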